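/- Let $Q$ be a quiver with finitely many vertices and arrows, and let $\operatorname{rep}(Q)$ be the category of its finite-dimensional complex representations. Let $d\ge 1$ and let $\widehat Q$ be one of the following two quivers with vertex set $v(\widehat Q)=v(Q)\times\{1,\dots,d\}$. * The extended quiver $Q_d$. Its arrows are $(i,r)\to(i,r+1)$ for $i\in v(Q)$, $1\le r\le d-1$, and $(i,r)\to(j,r)$ for every arrow $i\to j$ of $Q$ and $1\le r\le d$. Its virtual arrows are $(i,r)\dashrightarrow(j,r+1)$ for every arrow $i\to j$ of $Q$ and $1\le r\le d-1$. * The strict extended quiver $Q_{d,\mathrm{str}}$, for $d\ge 2$. Its arrows are $(i,r)\to(i,r+1)$ for $i\in v(Q)$, $1\le r\le d-1$, and $(i,r)\to(j,r-1)$ for every arrow $i\to j$ of $Q$ and $2\le r\le d$. Its virtual arrows are $(i,r)\dashrightarrow(j,r)$ for every arrow $i\to j$ of $Q$ and $2\le r\le d-1$. For every virtual arrow coming from an arrow $a$ of $Q$ there are two paths of length two in $\widehat Q$ with the same source and target as the virtual arrow and made of one arrow $(\cdot,r)\to(\cdot,r+1)$ and one arrow coming from $a$, in either order. Let $R$ be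 the quotient of the path algebra $\mathbb C\widehat Q$ by the ideal that identifies these two paths for every virtual arrow. For $X\in\operatorname{rep}(Q)$ let $\Phi(X)$ be the $R$-module with $\Phi(X)_{(i,r)}=X_i$, on which the arrows $(i,r)\to(i,r+1)$ act as the identity and an arrow of $\widehat Q$ coming from $i\to j$ acts as $X_{i\to j}$; this defines a functor $\Phi$. For functions $f,g:v(\widehat Q)\to\mathbb Z$ put $$\langle f,g\rangle_R=\sum_{x\in v(\widehat Q)}f_xg_x-\sum_{b:x\to y\text{ arrow}}f_xg_y+\sum_{c:x\dashrightarrow y\text{ virtual arrow}}f_xg_y .$$ For a finite-dimensional $R$-module $T$ let $\operatorname{Gr}(T)$ be the set of its $R$-submodules and $\operatorname{Gr}_f(T)$ the subset of submodules with dimension vector $f$, with the (reduced) variety structure induced from the product of the Grassmannians of subspaces of the $T_x$, $x\in v(\widehat Q)$. Let $\eta:0\to X\xrightarrow{\iota}Y\xrightarrow{\pi}S\to0$ be a short exact sequence in $\operatorname{rep}(Q)$ and let $$\Psi:\operatorname{Gr}(\Phi(Y))\to\operatorname{Gr}(\Phi(X))\times\operatorname{Gr}(\Phi(S)),\qquad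 U\mapsto\big(\Phi(\iota)^{-1}(U),\Phi(\pi)(U)\big).$$ For $f,g:v(\widehat Q)\to\mathbb Z$ let $\operatorname{Gr}(\Phi(Y))_{f,g}=\Psi^{-1}\big(\operatorname{Gr}_f(\Phi(X))\times\operatorname{Gr}_g(\Phi(S))\big)$, with the variety structure induced from $\operatorname{Gr}(\Phi(Y))$, and let $$\Psi_{f,g}:\operatorname{Gr}(\Phi(Y))_{f,g}\to\operatorname{Gr}_f(\Phi(X))\times\operatorname{Gr}_g(\Phi(S))$$ be the restriction of $\Psi$. 1. If $\eta$ splits, then $\Psi$ is surjective. 2. If $\operatorname{Ext}^1(S,X)=0$ (so that $\eta$ splits), then for all $f,g$ the map $\Psi_{f,g}$ is a Zariski-locally trivial affine bundle of rank $\langle g,\dim\Phi(X)-f\rangle_R$. That is, $\Psi_{f,g}$ is a morphism of varieties, and if its target is non-empty, then $n=\langle g,\dim\Phi(X)-f\rangle_R$ is non-negative and the target is covered by Zariski-open subsets $O$ with isomorphisms of varieties $\Psi_{f,g}^{-1}(O)\cong O\times\mathbb A^n$ over $O$, such that the transition maps between any two of them are affine-linear on every fibre $\mathbb A^n$. -/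

import Mathlib

open CategoryTheory Topology

universe u v w

noncomputable section

/-! ## Complex varieties, in the classical sense

A variety is a set covered by charts; every chart carries a set of coordinate functions,
and the polynomials in them play the role of the coordinate ring of the chart. -/

/-- A chart on a set `X`: a subset together with coordinate functions on it (the values of the
functions outside `dom` are irrelevant). -/
structure AlgChart (X : Type*) where
  dom : Set X
  coord : Set (X → ℂ)

namespace AlgChart

/-- The polynomials in the coordinate functions of the chart. -/
def ring {X : Type*} (c : AlgChart X) : Subalgebra ℂ (X → ℂ) := Algebra.adjoin ℂ c.coord

/-- The chart induced along a map. -/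
def pullback {X Y : Type*} (F : X → Y) (c : AlgChart Y) : AlgChart X where
  dom := F ⁻¹' c.dom
  coord := {a | ∃ b ∈ c.coord, a = b ∘ F}

/-- The product of two charts. -/
def prod {X Y : Type*} (c : AlgChart X) (c' : AlgChart Y) : AlgChart (X × Y) where
  dom := c.dom ×ˢ c'.dom
  coord := {a | (∃ b ∈ c.coord, a = b ∘ Prod.fst) ∨ (∃ b ∈ c'.coord, a = b ∘ Prod.snd)}

/-- The product of a family of charts. -/
def pi {J : Type*} {X : J → Type*} (c : ∀ j, AlgChart (X j)) : AlgChart (∀ j, X j) where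
  dom := {x | ∀ j, x j ∈ (c j).dom}
  coord := {a | ∃ j, ∃ b ∈ (c j).coord, a = fun x => b (x j)}

end AlgChart

/-- A set covered by charts. -/
structure AlgAtlas (X : Type*) where
  charts : Set (AlgChart X)
  cover : ∀ x, ∃ c ∈ charts, x ∈ c.dom

namespace AlgAtlas

/-- The Zariski topology: it is generated by the non-vanishing loci, in the charts, of the
polynomials in the coordinates. -/
@[reducible] def zariski {X : Type*} (A : AlgAtlas X) : TopologicalSpace X :=
  TopologicalSpace.generateFrom {U | ∃ c ∈ A.charts, ∃ a ∈ c.ring, U = {x ∈ c.dom | a x ≠ 0}}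

/-- `f` is a regular function on the subset `U` (only used for open `U`): locally, in some chart,
it is a quotient of polynomials in the coordinates. -/
def IsRegularOn {X : Type*} (A : AlgAtlas X) (U : Set X) (f : X → ℂ) : Prop :=
  ∀ x ∈ U, ∃ N : Set X, IsOpen[A.zariski] N ∧ x ∈ N ∧ N ⊆ U ∧
    ∃ c ∈ A.charts, N ⊆ c.dom ∧
      ∃ a ∈ c.ring, ∃ b ∈ c.ring, ∀ y ∈ N, b y ≠ 0 ∧ f y = a y / b y

/-- Morphisms of varieties: continuous maps which pull back regular functions to regular
functions. -/
def IsMorphism {X Y : Type*} (A : AlgAtlas X) (B : AlgAtlas Y) (F : X → Y) : Prop :=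
  @Continuous X Y A.zariski B.zariski F ∧
    ∀ (U : Set Y) (f : Y → ℂ), IsOpen[B.zariski] U → B.IsRegularOn U f →
      A.IsRegularOn (F ⁻¹' U) (f ∘ F)

/-- The structure induced along a map `F : X → Y`; used for injective `F`, where it is the
structure of a (reduced) subvariety. -/
def induced {X Y : Type*} (F : X → Y) (B : AlgAtlas Y) : AlgAtlas X where
  charts := {c | ∃ c' ∈ B.charts, c = c'.pullback F}
  cover x := by
    obtain ⟨c, hc, hx⟩ := B.cover (F x)
    exact ⟨_, ⟨c, hc, rfl⟩, hx⟩

/-- The product of two varieties. -/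
def prod {X Y : Type*} (A : AlgAtlas X) (B : AlgAtlas Y) : AlgAtlas (X × Y) where
  charts := {c | ∃ a ∈ A.charts, ∃ b ∈ B.charts, c = a.prod b}
  cover x := by
    obtain ⟨a, ha, hxa⟩ := A.cover x.1
    obtain ⟨b, hb, hxb⟩ := B.cover x.2
    exact ⟨_, ⟨a, ha, b, hb, rfl⟩, hxa, hxb⟩

/-- The product of a (finite) family of varieties. -/
def pi {J : Type*} {X : J → Type*} (A : ∀ j, AlgAtlas (X j)) : AlgAtlas (∀ j, X j) where
  charts := {c | ∃ a : ∀ j, AlgChart (X j), (∀ j, a j ∈ (A j).charts) ∧ c = AlgChart.pi a}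
  cover x := by
    choose a ha hx using fun j => (A j).cover (x j)
    exact ⟨_, ⟨a, ha, rfl⟩, hx⟩

/-- The affine space `𝔸ⁿ`. -/
def affineSpace (n : ℕ) : AlgAtlas (Fin n → ℂ) where
  charts := {⟨Set.univ, {a | ∃ i, a = fun x => x i}⟩}
  cover x := ⟨_, rfl, Set.mem_univ x⟩

end AlgAtlas

/-- The projection `E → E` with image `U` and kernel `C` (zero if `U`, `C` are not
complementary). -/
def projAlong {E : Type*} [AddCommGroup E] [Module ℂ E] (U C : Submodule ℂ E) : E →ₗ[ℂ] E :=
  open Classical in if h : IsCompl U C then U.projection C h else 0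

/-- The (disjoint union of all the) Grassmannian varieties of subspaces of a finite-dimensional
space `E`, with the standard affine charts: for each subspace `C` the subspaces `U` complementary
to `C`; its coordinates are the matrix entries of the projection onto `U` along `C`. -/
def grassmannAtlas (E : Type*) [AddCommGroup E] [Module ℂ E] : AlgAtlas (Submodule ℂ E) where
  charts := {c | ∃ C : Submodule ℂ E,
    c = ⟨{U | IsCompl U C},
      {a | ∃ (φ : Module.Dual ℂ E) (t : E), a = fun U => φ (projAlong U C t)}⟩}
  cover U := by
    obtain ⟨C, hC⟩ := U.exists_isCompl
    exact ⟨_, ⟨C, rfl⟩, hC⟩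

/-- A trivialization of `p : E → B` over an open subset, with fibre `𝔸ⁿ`. -/
structure LocalTriv {E B : Type*} (𝓔 : AlgAtlas E) (𝓑 : AlgAtlas B) (p : E → B) (n : ℕ) where
  base : Set B
  isOpen_base : IsOpen[𝓑.zariski] base
  equiv : (p ⁻¹' base) ≃ base × (Fin n → ℂ)
  fst_equiv : ∀ u, ((equiv u).1 : B) = p u
  morphism : (AlgAtlas.induced Subtype.val 𝓔).IsMorphism
    ((AlgAtlas.induced Subtype.val 𝓑).prod (AlgAtlas.affineSpace n)) equiv
  morphism_symm : ((AlgAtlas.induced Subtype.val 𝓑).prod (AlgAtlas.affineSpace n)).IsMorphism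
    (AlgAtlas.induced Subtype.val 𝓔) equiv.symm

/-- `p : E → B` is a Zariski-locally trivial affine bundle of rank `r`: it is a morphism, and `B` is
covered by open subsets over which `p` is isomorphic to the product with `𝔸ʳ`, in such a way that
the transition maps are affine-linear on every fibre. (An empty base has a bundle of every rank.) -/
def IsAffineBundle {E B : Type*} (𝓔 : AlgAtlas E) (𝓑 : AlgAtlas B) (p : E → B) (r : ℤ) : Prop :=
  𝓔.IsMorphism 𝓑 p ∧
  ∃ n : ℕ, (Nonempty B → (n : ℤ) = r) ∧
    ∃ τ : B → LocalTriv 𝓔 𝓑 p n,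
      (∀ b, b ∈ (τ b).base) ∧
      ∀ b b' x, ∀ (hx : x ∈ (τ b).base) (hx' : x ∈ (τ b').base),
        ∃ L : (Fin n → ℂ) ≃ᵃ[ℂ] (Fin n → ℂ), ∀ (u : E) (hu : p u = x),
          ((τ b').equiv ⟨u, by rw [Set.mem_preimage, hu]; exact hx'⟩).2 =
            L ((τ b).equiv ⟨u, by rw [Set.mem_preimage, hu]; exact hx⟩).2

/-! ## Representations of quivers -/

/-- Complex representations of a quiver (of any dimension), i.e. modules over its path algebra. -/
abbrev QRep (W : Type u) [Quiver.{v} W] := Paths W ⥤ ModuleCat.{w} ℂ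

namespace QRep

variable {W : Type u} [Quiver.{v} W]

/-- The space at a vertex. -/
abbrev sp (T : QRep.{u, v, w} W) (x : W) : Type w := T.obj ((Paths.of W).obj x)

/-- The linear map of an arrow. -/
abbrev act (T : QRep.{u, v, w} W) {x y : W} (b : x ⟶ y) : T.sp x →ₗ[ℂ] T.sp y :=
  (T.map ((Paths.of W).map b)).hom

/-- The component of a morphism of representations at a vertex. -/
abbrev homAt {T T' : QRep.{u, v, w} W} (φ : T ⟶ T') (x : W) : T.sp x →ₗ[ℂ] T'.sp x :=
  (φ.app ((Paths.of W).obj x)).hom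

lemma homAt_act {T T' : QRep.{u, v, w} W} (φ : T ⟶ T') {x y : W} (b : x ⟶ y) (t : T.sp x) :
    homAt φ y (T.act b t) = T'.act b (homAt φ x t) := by
  have h := φ.naturality ((Paths.of W).map b)
  exact congrArg (fun m => m.hom t) h

/-- The representation is finite-dimensional (the quivers in question have finitely many
vertices). -/
def IsFinDim (T : QRep.{u, v, w} W) : Prop := ∀ x, FiniteDimensional ℂ (T.sp x)

/-- The dimension vector. -/
def dimVec (T : QRep.{u, v, w} W) : W → ℤ := fun x => (Module.finrank ℂ (T.sp x) : ℤ)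

/-- `Extⁿ(S, X) = 0` in the abelian category of representations. -/
def ExtVanishes (S X : QRep.{u, v, w} W) (n : ℕ) : Prop :=
  haveI := HasExt.standard (QRep.{u, v, w} W)
  Subsingleton (Abelian.Ext S X n)

end QRep

/-- Subrepresentations. -/
@[ext]
structure SubRep {W : Type u} [Quiver.{v} W] (T : QRep.{u, v, w} W) where
  carrier : ∀ x : W, Submodule ℂ (T.sp x)
  stable : ∀ {x y : W} (b : x ⟶ y), ∀ t ∈ carrier x, T.act b t ∈ carrier y

namespace SubRep

variable {W : Type u} [Quiver.{v} W] {T T' : QRep.{u, v, w} W}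

/-- The dimension vector of a subrepresentation. -/
def dimVec (U : SubRep T) : W → ℤ := fun x => (Module.finrank ℂ (U.carrier x) : ℤ)

/-- The preimage of a subrepresentation. -/
def comap (φ : T ⟶ T') (U : SubRep T') : SubRep T where
  carrier x := (U.carrier x).comap (QRep.homAt φ x)
  stable b t ht := by
    rw [Submodule.mem_comap, QRep.homAt_act]
    exact U.stable b _ ht

/-- The image of a subrepresentation. -/
def map (φ : T ⟶ T') (U : SubRep T) : SubRep T' where
  carrier x := (U.carrier x).map (QRep.homAt φ x)
  stable b t ht := by
    obtain ⟨t, ht, rfl⟩ := ht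
    exact ⟨_, U.stable b t ht, QRep.homAt_act φ b t⟩

end SubRep

/-! ## Extended quivers -/

/-- Partial flags and strict partial flags. -/
inductive FlagKind
  | plain
  | strict

/-- The vertices `(i, r)` of the extended quiver `Q_d` (kind `plain`) or of the strict extended
quiver `Q_{d,str}` (kind `strict`). The levels `1, …, d` are numbered `0, …, d - 1`. -/
def ExtVertex (_ : FlagKind) (V : Type u) (d : ℕ) : Type u := V × Fin d

/-- The arrows of the (strict) extended quiver: `(i, r) ⟶ (i, r + 1)` in both cases, and for each
arrow `i ⟶ j` of `Q` the arrows `(i, r) ⟶ (j, r)`, respectively `(i, r) ⟶ (j, r - 1)`. -/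
inductive ExtArrow {V : Type u} [Quiver.{v} V] {d : ℕ} :
    (k : FlagKind) → ExtVertex k V d → ExtVertex k V d → Type (max u v)
  | up {k : FlagKind} (i : V) {r s : Fin d} (h : r.val + 1 = s.val) : ExtArrow k (i, r) (i, s)
  | plain {i j : V} (a : i ⟶ j) (r : Fin d) : ExtArrow .plain (i, r) (j, r)
  | strict {i j : V} (a : i ⟶ j) {r s : Fin d} (h : s.val + 1 = r.val) :
      ExtArrow .strict (i, r) (j, s)

/-- The virtual arrows: for each arrow `i ⟶ j` of `Q` the virtual arrows `(i, r) ⟶ (j, r + 1)`,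
where `1 ≤ r ≤ d - 1`, respectively `(i, r) ⟶ (j, r)`, where `2 ≤ r ≤ d - 1`. -/
inductive VirtualArrow {V : Type u} [Quiver.{v} V] {d : ℕ} :
    (k : FlagKind) → ExtVertex k V d → ExtVertex k V d → Type (max u v)
  | plain {i j : V} (a : i ⟶ j) {r s : Fin d} (h : r.val + 1 = s.val) :
      VirtualArrow .plain (i, r) (j, s)
  | strict {i j : V} (a : i ⟶ j) {q r s : Fin d} (h : q.val + 1 = r.val)
      (h' : r.val + 1 = s.val) : VirtualArrow .strict (i, r) (j, r)

section Extended

variable {k : FlagKind} {V : Type u} [Quiver.{v} V] {d : ℕ}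

instance : Quiver.{max u v} (ExtVertex k V d) where
  Hom := ExtArrow k

instance [Fintype V] : Fintype (ExtVertex k V d) := inferInstanceAs (Fintype (V × Fin d))

/-- The path of length two from the source to the target of a virtual arrow which first goes one
level up. -/
def VirtualArrow.upFirst : ∀ {x y : ExtVertex k V d}, VirtualArrow k x y → Quiver.Path x y
  | _, _, .plain (i := i) a (s := s) h =>
      (Quiver.Path.nil.cons (ExtArrow.up i h)).cons (ExtArrow.plain a s)
  | _, _, .strict (i := i) a _ h' =>
      (Quiver.Path.nil.cons (ExtArrow.up i h')).cons (ExtArrow.strict a h')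

/-- The path of length two from the source to the target of a virtual arrow which goes one level up
in the second step. -/
def VirtualArrow.upLast : ∀ {x y : ExtVertex k V d}, VirtualArrow k x y → Quiver.Path x y
  | _, _, .plain (j := j) a (r := r) h =>
      (Quiver.Path.nil.cons (ExtArrow.plain a r)).cons (ExtArrow.up j h)
  | _, _, .strict (j := j) a h _ =>
      (Quiver.Path.nil.cons (ExtArrow.strict a h)).cons (ExtArrow.up j h)

variable (k V d) in
/-- The modules over the algebra `R` (`= R_d` or `R_{d,str}`), the quotient of the path algebra of the
(strict) extended quiver by the commutativity relations: the two paths belonging to a virtual arrow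
act in the same way. -/
def IsRModule : ObjectProperty (QRep.{u, max u v, w} (ExtVertex k V d)) := fun T =>
  ∀ {x y : ExtVertex k V d} (c : VirtualArrow k x y),
    T.map (X := (Paths.of _).obj x) (Y := (Paths.of _).obj y) c.upFirst = T.map c.upLast

variable (k V d) in
/-- The category of `R`-modules. -/
abbrev RMod := (IsRModule.{u, v, w} k V d).FullSubcategory

/-- The arrows of `Φ(X)`: identities for the arrows `(i, r) ⟶ (i, r + 1)`, the map of the arrow
`i ⟶ j` for the other ones. -/
def PhiArrow (X : QRep.{u, v, w} V) : ∀ {x y : ExtVertex k V d}, (x ⟶ y) →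
    (X.obj ((Paths.of V).obj x.1) ⟶ X.obj ((Paths.of V).obj y.1))
  | _, _, .up _ _ => 𝟙 _
  | _, _, .plain a _ => X.map ((Paths.of V).map a)
  | _, _, .strict a _ => X.map ((Paths.of V).map a)

/-- The representation of the extended quiver underlying `Φ(X)`. -/
def PhiRep (X : QRep.{u, v, w} V) : QRep.{u, max u v, w} (ExtVertex k V d) :=
  Paths.lift { obj := fun x => X.obj ((Paths.of V).obj x.1), map := fun b => PhiArrow X b }

lemma PhiRep_isRModule (X : QRep.{u, v, w} V) : IsRModule k V d (PhiRep X) := by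
  intro x y c
  cases c <;> rfl

lemma PhiArrow_naturality {X Y : QRep.{u, v, w} V} (φ : X ⟶ Y) {x y : ExtVertex k V d}
    (b : x ⟶ y) : PhiArrow X b ≫ φ.app ((Paths.of V).obj y.1) =
      φ.app ((Paths.of V).obj x.1) ≫ PhiArrow Y b := by
  match x, y, b with
  | _, _, .up _ _ => exact (Category.id_comp _).trans (Category.comp_id _).symm
  | _, _, .plain _ _ => exact φ.naturality _
  | _, _, .strict _ _ => exact φ.naturality _

variable (k d) in
/-- The canonical functor `Φ`. -/
def Phi : QRep.{u, v, w} V ⥤ RMod.{u, v, w} k V d where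
  obj X := ⟨PhiRep X, PhiRep_isRModule X⟩
  map {X Y} φ := ObjectProperty.homMk
    (Paths.liftNatTrans (fun x => φ.app ((Paths.of V).obj x.1)) (by
      intro x y b
      refine Eq.trans ?_ ((PhiArrow_naturality φ b).trans ?_)
      · exact congrArg (· ≫ _) (Category.id_comp (PhiArrow X b))
      · exact congrArg (_ ≫ ·) (Category.id_comp (PhiArrow Y b)).symm))
  map_id _ := rfl
  map_comp _ _ := rfl

variable (k V d) in
/-- The set of arrows of the (strict) extended quiver. -/
abbrev AllArrows := Σ x y : ExtVertex k V d, ExtArrow k x y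

variable (k V d) in
/-- The set of virtual arrows. -/
abbrev AllVirtualArrows := Σ x y : ExtVertex k V d, VirtualArrow k x y

end Extended

section Grassmannians

variable {k : FlagKind} {V : Type u} [Quiver.{v} V] {d : ℕ}

/-- The arrow of `Q` behind an arrow of the extended quiver, if there is one. -/
def ExtArrow.code : ∀ {x y : ExtVertex k V d}, ExtArrow k x y → Option (x.1 ⟶ y.1)
  | _, _, .up _ _ => none
  | _, _, .plain a _ => some a
  | _, _, .strict a _ => some a

lemma ExtArrow.code_injective : ∀ {x y : ExtVertex k V d} (b b' : ExtArrow k x y),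
    b.code = b'.code → b = b'
  | _, _, .up _ _, .up _ _, _ => rfl
  | _, _, .up _ _, .plain _ _, h => by simp [code] at h
  | _, _, .up _ _, .strict _ _, h => by simp [code] at h
  | _, _, .plain _ _, .up _ _, h => by simp [code] at h
  | _, _, .plain _ _, .plain _ _, h => by cases h; rfl
  | _, _, .strict _ _, .up _ _, h => by simp [code] at h
  | _, _, .strict _ _, .strict _ _, h => by cases h; rfl

/-- The arrow of `Q` behind a virtual arrow. -/
def VirtualArrow.code : ∀ {x y : ExtVertex k V d}, VirtualArrow k x y → (x.1 ⟶ y.1)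
  | _, _, .plain a _ => a
  | _, _, .strict a _ _ => a

lemma VirtualArrow.code_injective : ∀ {x y : ExtVertex k V d} (c c' : VirtualArrow k x y),
    c.code = c'.code → c = c'
  | _, _, .plain _ _, .plain _ _, h => by cases h; rfl
  | _, _, .strict (q := q) (s := s) _ _ _, .strict (q := q') (s := s') _ _ _, h => by
    obtain rfl : q = q' := Fin.ext (by omega)
    obtain rfl : s = s' := Fin.ext (by omega)
    cases h
    rfl

instance [Fintype V] [∀ i j : V, Fintype (i ⟶ j)] : Fintype (AllArrows k V d) :=
  haveI (x y : ExtVertex k V d) : Finite (ExtArrow k x y) :=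
    Finite.of_injective ExtArrow.code ExtArrow.code_injective
  Fintype.ofFinite _

instance [Fintype V] [∀ i j : V, Fintype (i ⟶ j)] : Fintype (AllVirtualArrows k V d) :=
  haveI (x y : ExtVertex k V d) : Finite (VirtualArrow k x y) :=
    Finite.of_injective VirtualArrow.code VirtualArrow.code_injective
  Fintype.ofFinite _

/-- The Euler form `⟨f, g⟩_R` of two dimension vectors. -/
def eulerForm [Fintype V] [∀ i j : V, Fintype (i ⟶ j)] (f g : ExtVertex k V d → ℤ) : ℤ :=
  ∑ x, f x * g x - ∑ b : AllArrows k V d, f b.1 * g b.2.1 +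
    ∑ c : AllVirtualArrows k V d, f c.1 * g c.2.1

/-- The Grassmannian `Gr(T)` of all submodules of an `R`-module. -/
abbrev Gr (T : RMod.{u, v, w} k V d) := SubRep T.obj

/-- The variety structure of `Gr(T)`, as a subvariety of the product over all vertices of the
Grassmannians of subspaces. -/
def Gr.atlas (T : RMod.{u, v, w} k V d) : AlgAtlas (Gr T) :=
  AlgAtlas.induced (fun U => U.carrier) (AlgAtlas.pi fun x => grassmannAtlas (T.obj.sp x))

/-- The Grassmannian `Gr_f(T)` of submodules with dimension vector `f`. -/
abbrev GrDim (T : RMod.{u, v, w} k V d) (f : ExtVertex k V d → ℤ) := {U : Gr T // U.dimVec = f}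

/-- The variety structure of `Gr_f(T)`. -/
def GrDim.atlas (T : RMod.{u, v, w} k V d) (f : ExtVertex k V d → ℤ) : AlgAtlas (GrDim T f) :=
  AlgAtlas.induced Subtype.val (Gr.atlas T)

variable (k d)

/-- The map `Ψ : Gr(Φ(Y)) → Gr(Φ(X)) × Gr(Φ(S))`, `U ↦ (Φ(ι)⁻¹(U), Φ(π)(U))`, of a sequence
`η : X ⟶ Y ⟶ S` with maps `ι`, `π`. -/
def Psi (η : ShortComplex (QRep.{u, v, w} V)) (U : Gr ((Phi k d).obj η.X₂)) :
    Gr ((Phi k d).obj η.X₁) × Gr ((Phi k d).obj η.X₃) :=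
  (U.comap ((Phi k d).map η.f).hom, U.map ((Phi k d).map η.g).hom)

/-- The subset `Gr(Φ(Y))_{f,g}` of `Gr(Φ(Y))`, the preimage of `Gr_f(Φ(X)) × Gr_g(Φ(S))`
under `Ψ`. -/
abbrev GrFiber (η : ShortComplex (QRep.{u, v, w} V)) (f g : ExtVertex k V d → ℤ) :=
  {U : Gr ((Phi k d).obj η.X₂) // (Psi k d η U).1.dimVec = f ∧ (Psi k d η U).2.dimVec = g}

/-- The variety structure of `Gr(Φ(Y))_{f,g}`. -/
def GrFiber.atlas (η : ShortComplex (QRep.{u, v, w} V)) (f g : ExtVertex k V d → ℤ) :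
    AlgAtlas (GrFiber k d η f g) :=
  AlgAtlas.induced Subtype.val (Gr.atlas ((Phi k d).obj η.X₂))

/-- The restriction `Ψ_{f,g}` of `Ψ`. -/
def PsiDim (η : ShortComplex (QRep.{u, v, w} V)) (f g : ExtVertex k V d → ℤ)
    (U : GrFiber k d η f g) :
    GrDim ((Phi k d).obj η.X₁) f × GrDim ((Phi k d).obj η.X₃) g :=
  (⟨(Psi k d η U.1).1, U.2.1⟩, ⟨(Psi k d η U.1).2, U.2.2⟩)

end Grassmannians

end

/-! A splitting makes Φ(Y) the direct sum of Φ(X) and Φ(S), vertex by vertex and compatibly with the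
arrows. A submodule U of Φ(Y) with intersection A with Φ(X) and image B in Φ(S) is then a graph,
consisting of the y with π y ∈ B and ρ y ∈ H(π y) + A. Here H is a family of linear maps that
induces a homomorphism from B to Φ(X)/A, and only the induced homomorphism matters. So the fibre of
Ψ over (A, B) is Hom(B, Φ(X)/A), and H = 0 gives surjectivity.

The dimension of this fibre comes from a three-term complex: linear maps Hom(S, X) at the vertices,
along the arrows and along the virtual arrows, with differentials `extCommutator` and `extRelator`
(the linearized commutativity relations). Replacing S by B and X by Φ(X)/A turns the alternating sum
of dimensions into the Euler form, and the cohomology in degree zero is Hom(B, Φ(X)/A). The last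
differential is surjective because sequences with prescribed differences exist. In degree one
(`exists_extCommutator`), a cocycle is first made zero on the arrows (i,r) → (i,r+1). What remains
is, for each arrow of Q, a sequence of maps that is constant modulo the filtrations. It may be
replaced by one map (`exists_constant_of_filtered`), and the resulting family on Q is a coboundary
since Ext¹(S, X) = 0. Hence the fibre dimension is the Euler form, independently of A and B.

For local triviality, fix complements C of A and D of B. Each homomorphism has a unique
representative H in normal form, zero on D and with values in C, and this H is the entry S → X of
the projection onto U along C ⊕ D, hence regular in U. The normal forms are the kernel of a linear
map T(q) depending regularly on q = (A, B). Its kernel has constant dimension, so 1 + R(T(q) −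
T(q₀)), with R a generalized inverse of T(q₀), identifies the kernel at q with the kernel at q₀
wherever its determinant does not vanish (`inverse_mem_ker`). This gives the trivializations.
Changing the complements only renormalizes H, so the transition maps are even linear.

Regularity is checked in charts (`isMorphism_of_chartMap`), where it becomes a statement about
matrix entries of projections; inverses are handled by Cramer's rule. -/

noncomputable section

/-! ## Local rings of charts and maps between charts -/

/-- Precomposition with a map, as a homomorphism of algebras of functions. -/
def precompAlgHom {X Y : Type*} (F : X → Y) : (Y → ℂ) →ₐ[ℂ] (X → ℂ) where
  toFun a := a ∘ F
  map_one' := rfl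
  map_mul' _ _ := rfl
  map_zero' := rfl
  map_add' _ _ := rfl
  commutes' _ := rfl

namespace AlgChart

variable {X Y Z : Type*}

/-- The basic open subset of a chart on which a function does not vanish. -/
def basicOpen (c : AlgChart X) (h : X → ℂ) : Set X := {x ∈ c.dom | h x ≠ 0}

lemma coord_mem_ring {c : AlgChart X} {a : X → ℂ} (ha : a ∈ c.coord) : a ∈ c.ring :=
  Algebra.subset_adjoin ha

/-- The functions which are quotients of polynomials in the coordinates near a point of the
chart. -/
def localRing (c : AlgChart X) (x : X) : Subalgebra ℂ (X → ℂ) where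
  carrier := {f | ∃ p ∈ c.ring, ∃ q ∈ c.ring, q x ≠ 0 ∧ ∀ y ∈ c.basicOpen q, f y = p y / q y}
  mul_mem' := by
    rintro f g ⟨p, hp, q, hq, h0, h⟩ ⟨p', hp', q', hq', h0', h'⟩
    refine ⟨p * p', mul_mem hp hp', q * q', mul_mem hq hq', mul_ne_zero h0 h0', ?_⟩
    rintro y ⟨hy, hn⟩
    have h1 : q y ≠ 0 := left_ne_zero_of_mul hn
    have h2 : q' y ≠ 0 := right_ne_zero_of_mul hn
    simp only [Pi.mul_apply, h y ⟨hy, h1⟩, h' y ⟨hy, h2⟩]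
    field_simp
  add_mem' := by
    rintro f g ⟨p, hp, q, hq, h0, h⟩ ⟨p', hp', q', hq', h0', h'⟩
    refine ⟨p * q' + p' * q, add_mem (mul_mem hp hq') (mul_mem hp' hq), q * q', mul_mem hq hq',
      mul_ne_zero h0 h0', ?_⟩
    rintro y ⟨hy, hn⟩
    have h1 : q y ≠ 0 := left_ne_zero_of_mul hn
    have h2 : q' y ≠ 0 := right_ne_zero_of_mul hn
    simp only [Pi.add_apply, Pi.mul_apply, h y ⟨hy, h1⟩, h' y ⟨hy, h2⟩]
    field_simp
  algebraMap_mem' z := ⟨algebraMap ℂ (X → ℂ) z, Subalgebra.algebraMap_mem _ _, 1, one_mem _,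
    one_ne_zero, fun y _ => by simp⟩

lemma ring_le_localRing (c : AlgChart X) (x : X) : c.ring ≤ c.localRing x := fun a ha =>
  ⟨a, ha, 1, one_mem _, one_ne_zero, fun y _ => by simp⟩

/-- Multiplying numerator and denominator by `h` shrinks the set on which the quotient formula has
to hold, so membership depends only on the values near the point. -/
lemma localRing_congr {c : AlgChart X} {x : X} {f g : X → ℂ} (hf : f ∈ c.localRing x)
    {h : X → ℂ} (hh : h ∈ c.ring) (hx : h x ≠ 0) (hfg : ∀ y ∈ c.basicOpen h, g y = f y) :
    g ∈ c.localRing x := by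
  obtain ⟨p, hp, q, hq, h0, H⟩ := hf
  refine ⟨p * h, mul_mem hp hh, q * h, mul_mem hq hh, mul_ne_zero h0 hx, ?_⟩
  rintro y ⟨hy, hn⟩
  have h1 : q y ≠ 0 := left_ne_zero_of_mul hn
  have h2 : h y ≠ 0 := right_ne_zero_of_mul hn
  rw [hfg y ⟨hy, h2⟩, H y ⟨hy, h1⟩]
  simp only [Pi.mul_apply]
  field_simp

lemma localRing_congr_dom {c : AlgChart X} {x : X} {f g : X → ℂ} (hf : f ∈ c.localRing x)
    (hfg : ∀ y ∈ c.dom, g y = f y) : g ∈ c.localRing x :=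
  localRing_congr hf (one_mem _) one_ne_zero fun y hy => hfg y hy.1

/-- A function of the local ring which does not vanish at the point is non-zero on a basic open
neighbourhood. -/
lemma exists_basicOpen_ne_zero {c : AlgChart X} {x : X} (hx : x ∈ c.dom) {f : X → ℂ}
    (hf : f ∈ c.localRing x) (h0 : f x ≠ 0) :
    ∃ h ∈ c.ring, h x ≠ 0 ∧ ∀ y ∈ c.basicOpen h, f y ≠ 0 := by
  obtain ⟨p, hp, q, hq, hq0, H⟩ := hf
  refine ⟨p * q, mul_mem hp hq, mul_ne_zero (fun hp0 => h0 ?_) hq0, ?_⟩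
  · rw [H x ⟨hx, hq0⟩, hp0, zero_div]
  · rintro y ⟨hy, hn⟩
    have h1 : p y ≠ 0 := left_ne_zero_of_mul hn
    have h2 : q y ≠ 0 := right_ne_zero_of_mul hn
    rw [H y ⟨hy, h2⟩]
    exact div_ne_zero h1 h2

lemma inv_mem_localRing {c : AlgChart X} {x : X} (hx : x ∈ c.dom) {f : X → ℂ}
    (hf : f ∈ c.localRing x) (h0 : f x ≠ 0) : f⁻¹ ∈ c.localRing x := by
  obtain ⟨p, hp, q, hq, hq0, H⟩ := hf
  have hp0 : p x ≠ 0 := fun hp0 => h0 (by rw [H x ⟨hx, hq0⟩, hp0, zero_div])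
  -- The inverse is q / p; the extra factor q confines the formula to the set where f = p / q is
  -- known.
  refine ⟨q * q, mul_mem hq hq, p * q, mul_mem hp hq, mul_ne_zero hp0 hq0, ?_⟩
  rintro y ⟨hy, hn⟩
  have h1 : p y ≠ 0 := left_ne_zero_of_mul hn
  have h2 : q y ≠ 0 := right_ne_zero_of_mul hn
  simp only [Pi.inv_apply, H y ⟨hy, h2⟩, Pi.mul_apply]
  field_simp

/-- In terms of the charts `c` and `c'`, the map `F` is regular at `x`. -/
structure ChartMap (c : AlgChart X) (c' : AlgChart Y) (F : X → Y) (x : X) : Prop where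
  mem_dom : x ∈ c.dom
  exists_subset : ∃ h ∈ c.ring, h x ≠ 0 ∧ ∀ y ∈ c.basicOpen h, F y ∈ c'.dom
  coord_mem : ∀ b ∈ c'.coord, b ∘ F ∈ c.localRing x

lemma ChartMap.of_forall_mem {c : AlgChart X} {c' : AlgChart Y} {F : X → Y} {x : X}
    (hx : x ∈ c.dom) (h : ∀ y ∈ c.dom, F y ∈ c'.dom)
    (hc : ∀ b ∈ c'.coord, b ∘ F ∈ c.localRing x) : ChartMap c c' F x :=
  ⟨hx, ⟨1, one_mem _, one_ne_zero, fun y hy => h y hy.1⟩, hc⟩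

namespace ChartMap

variable {c : AlgChart X} {c' : AlgChart Y} {c'' : AlgChart Z} {F : X → Y} {G : Y → Z} {x : X}

lemma map_mem_dom (H : ChartMap c c' F x) : F x ∈ c'.dom := by
  obtain ⟨h, _, h0, hs⟩ := H.exists_subset
  exact hs x ⟨H.mem_dom, h0⟩

/-- The functions whose composite with `F` is regular at `x` form a subalgebra, so it suffices to
know the coordinates. -/
lemma ring_mem (H : ChartMap c c' F x) {a : Y → ℂ} (ha : a ∈ c'.ring) :
    a ∘ F ∈ c.localRing x := by
  have : c'.ring ≤ (c.localRing x).comap (precompAlgHom F) := Algebra.adjoin_le H.coord_mem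
  exact this ha

lemma exists_basicOpen (H : ChartMap c c' F x) {a : Y → ℂ} (ha : a ∈ c'.ring) (h0 : a (F x) ≠ 0) :
    ∃ h ∈ c.ring, h x ≠ 0 ∧ ∀ y ∈ c.basicOpen h, F y ∈ c'.basicOpen a := by
  obtain ⟨h, hh, hx, hs⟩ := H.exists_subset
  obtain ⟨k, hk, kx, ks⟩ := exists_basicOpen_ne_zero H.mem_dom (H.ring_mem ha) h0
  refine ⟨h * k, mul_mem hh hk, mul_ne_zero hx kx, ?_⟩
  rintro y ⟨hy, hn⟩
  exact ⟨hs y ⟨hy, left_ne_zero_of_mul hn⟩, ks y ⟨hy, right_ne_zero_of_mul hn⟩⟩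

lemma localRing_mem (H : ChartMap c c' F x) {f : Y → ℂ} (hf : f ∈ c'.localRing (F x)) :
    f ∘ F ∈ c.localRing x := by
  obtain ⟨p, hp, q, hq, hq0, hf⟩ := hf
  obtain ⟨h, hh, hx, hs⟩ := H.exists_basicOpen hq hq0
  refine localRing_congr (mul_mem (H.ring_mem hp)
    (inv_mem_localRing H.mem_dom (H.ring_mem hq) hq0)) hh hx fun y hy => ?_
  simp only [Function.comp_apply, hf _ (hs y hy), Pi.mul_apply, Pi.inv_apply, div_eq_mul_inv]

lemma comp (H' : ChartMap c' c'' G (F x)) (H : ChartMap c c' F x) : ChartMap c c'' (G ∘ F) x := by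
  refine ⟨H.mem_dom, ?_, fun b hb => H.localRing_mem (H'.coord_mem b hb)⟩
  obtain ⟨h, hh, hx, hs⟩ := H'.exists_subset
  obtain ⟨k, hk, kx, ks⟩ := H.exists_basicOpen hh hx
  exact ⟨k, hk, kx, fun y hy => hs _ (ks y hy)⟩

end ChartMap

lemma chartMap_pullback_self (c : AlgChart Y) (F : X → Y) {x : X} (hx : F x ∈ c.dom) :
    ChartMap (c.pullback F) c F x :=
  .of_forall_mem hx (fun _ h => h) fun b hb => ring_le_localRing _ _ (coord_mem_ring ⟨b, hb, rfl⟩)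

/-- The universal property of an induced structure: regularity of a map into a subvariety can be
tested in the ambient variety. -/
lemma chartMap_pullback {c : AlgChart X} {c' : AlgChart Z} {F : X → Y} {G : Y → Z} {x : X}
    (H : ChartMap c c' (G ∘ F) x) : ChartMap c (c'.pullback G) F x :=
  ⟨H.mem_dom, H.exists_subset, by rintro _ ⟨b, hb, rfl⟩; exact H.coord_mem b hb⟩

lemma chartMap_prod {c : AlgChart X} {c' : AlgChart Y} {c'' : AlgChart Z} {F : X → Y × Z} {x : X}
    (H : ChartMap c c' (Prod.fst ∘ F) x) (H' : ChartMap c c'' (Prod.snd ∘ F) x) :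
    ChartMap c (c'.prod c'') F x := by
  refine ⟨H.mem_dom, ?_, ?_⟩
  · obtain ⟨h, hh, hx, hs⟩ := H.exists_subset
    obtain ⟨k, hk, kx, ks⟩ := H'.exists_subset
    refine ⟨h * k, mul_mem hh hk, mul_ne_zero hx kx, ?_⟩
    rintro y ⟨hy, hn⟩
    exact ⟨hs y ⟨hy, left_ne_zero_of_mul hn⟩, ks y ⟨hy, right_ne_zero_of_mul hn⟩⟩
  · rintro _ (⟨b, hb, rfl⟩ | ⟨b, hb, rfl⟩)
    · exact H.coord_mem b hb
    · exact H'.coord_mem b hb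

lemma chartMap_fst (c : AlgChart X) (c' : AlgChart Y) {x : X × Y} (hx : x ∈ (c.prod c').dom) :
    ChartMap (c.prod c') c Prod.fst x :=
  .of_forall_mem hx (fun _ h => h.1) fun b hb =>
    ring_le_localRing _ _ (coord_mem_ring (.inl ⟨b, hb, rfl⟩))

lemma chartMap_snd (c : AlgChart X) (c' : AlgChart Y) {x : X × Y} (hx : x ∈ (c.prod c').dom) :
    ChartMap (c.prod c') c' Prod.snd x :=
  .of_forall_mem hx (fun _ h => h.2) fun b hb =>
    ring_le_localRing _ _ (coord_mem_ring (.inr ⟨b, hb, rfl⟩))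

lemma chartMap_pi {J : Type*} [Fintype J] {Y : J → Type*} {c : AlgChart X}
    {c' : ∀ j, AlgChart (Y j)} {F : X → ∀ j, Y j} {x : X} (hx : x ∈ c.dom)
    (H : ∀ j, ChartMap c (c' j) (fun y => F y j) x) : ChartMap c (pi c') F x := by
  refine ⟨hx, ?_, ?_⟩
  · choose h hh hx hs using fun j => (H j).exists_subset
    refine ⟨∏ j, h j, prod_mem fun j _ => hh j, ?_, ?_⟩
    · rw [Finset.prod_apply]
      exact Finset.prod_ne_zero_iff.2 fun j _ => hx j
    · rintro y ⟨hy, hn⟩ j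
      rw [Finset.prod_apply] at hn
      exact hs j y ⟨hy, Finset.prod_ne_zero_iff.1 hn j (Finset.mem_univ j)⟩
  · rintro _ ⟨j, b, hb, rfl⟩
    exact (H j).coord_mem b hb

lemma chartMap_eval {J : Type*} {Y : J → Type*} (c : ∀ j, AlgChart (Y j)) {x : ∀ j, Y j}
    (hx : x ∈ (pi c).dom) (j : J) : ChartMap (pi c) (c j) (fun y => y j) x :=
  .of_forall_mem hx (fun _ h => h j) fun b hb =>
    ring_le_localRing _ _ (coord_mem_ring ⟨j, b, hb, rfl⟩)

end AlgChart

/-! ## Compatible atlases -/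

namespace AlgAtlas

open AlgChart

variable {X Y : Type*}

/-- The changes of charts are regular. -/
def IsCompatible (A : AlgAtlas X) : Prop :=
  ∀ c ∈ A.charts, ∀ c' ∈ A.charts, ∀ x ∈ c.dom, x ∈ c'.dom → ChartMap c c' id x

lemma IsCompatible.induced {B : AlgAtlas Y} (hB : B.IsCompatible) (F : X → Y) :
    (AlgAtlas.induced F B).IsCompatible := by
  rintro _ ⟨c, hc, rfl⟩ _ ⟨c', hc', rfl⟩ x hx hx'
  exact chartMap_pullback ((hB c hc c' hc' (F x) hx hx').comp (chartMap_pullback_self c F hx))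

lemma IsCompatible.prod {A : AlgAtlas X} {B : AlgAtlas Y} (hA : A.IsCompatible)
    (hB : B.IsCompatible) : (A.prod B).IsCompatible := by
  rintro _ ⟨a, ha, b, hb, rfl⟩ _ ⟨a', ha', b', hb', rfl⟩ x hx hx'
  exact chartMap_prod ((hA a ha a' ha' x.1 hx.1 hx'.1).comp (chartMap_fst a b hx))
    ((hB b hb b' hb' x.2 hx.2 hx'.2).comp (chartMap_snd a b hx))

lemma IsCompatible.pi {J : Type*} [Fintype J] {X : J → Type*} {A : ∀ j, AlgAtlas (X j)}
    (hA : ∀ j, (A j).IsCompatible) : (AlgAtlas.pi A).IsCompatible := by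
  rintro _ ⟨a, ha, rfl⟩ _ ⟨a', ha', rfl⟩ x hx hx'
  exact chartMap_pi hx fun j =>
    ((hA j _ (ha j) _ (ha' j) (x j) (hx j) (hx' j)).comp (chartMap_eval a hx j) :)

lemma isCompatible_affineSpace (n : ℕ) : (affineSpace n).IsCompatible := by
  rintro _ rfl _ rfl x hx _
  exact .of_forall_mem hx (fun _ h => h) fun b hb => ring_le_localRing _ _ (coord_mem_ring hb)

lemma isOpen_basicOpen (A : AlgAtlas X) {c : AlgChart X} (hc : c ∈ A.charts) {h : X → ℂ}
    (hh : h ∈ c.ring) : IsOpen[A.zariski] (c.basicOpen h) :=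
  TopologicalSpace.isOpen_generateFrom_of_mem ⟨c, hc, h, hh, rfl⟩

lemma isOpen_of_forall_basicOpen (A : AlgAtlas X) {U : Set X}
    (hU : ∀ x ∈ U, ∃ c ∈ A.charts, x ∈ c.dom ∧ ∃ h ∈ c.ring, h x ≠ 0 ∧ c.basicOpen h ⊆ U) :
    IsOpen[A.zariski] U := by
  let := A.zariski
  rw [isOpen_iff_mem_nhds]
  intro x hx
  obtain ⟨c, hc, hxc, h, hh, h0, hs⟩ := hU x hx
  exact Filter.mem_of_superset ((A.isOpen_basicOpen hc hh).mem_nhds ⟨hxc, h0⟩) hs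

/-- A map which is regular in terms of charts is a morphism of varieties. -/
lemma isMorphism_of_chartMap {A : AlgAtlas X} {B : AlgAtlas Y} (hB : B.IsCompatible) {F : X → Y}
    (H : ∀ x, ∃ c ∈ A.charts, ∃ c' ∈ B.charts, ChartMap c c' F x) : A.IsMorphism B F := by
  -- Open sets and regular functions on the target are given in arbitrary charts; compatibility
  -- passes from one target chart at F x to all of them.
  have H' : ∀ x, ∃ c ∈ A.charts, ∀ c'' ∈ B.charts, F x ∈ c''.dom → ChartMap c c'' F x := by
    intro x
    obtain ⟨c, hc, c', hc', h⟩ := H x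
    exact ⟨c, hc, fun c'' hc'' hx => ChartMap.comp (G := id)
      (hB c' hc' c'' hc'' (F x) h.map_mem_dom hx) h⟩
  have hcont : @Continuous X Y A.zariski B.zariski F := by
    let := A.zariski
    refine continuous_generateFrom_iff.2 ?_
    rintro _ ⟨c'', hc'', a, ha, rfl⟩
    refine A.isOpen_of_forall_basicOpen fun x hx => ?_
    obtain ⟨c, hc, h⟩ := H' x
    have h := h c'' hc'' hx.1
    exact ⟨c, hc, h.mem_dom, h.exists_basicOpen ha hx.2⟩
  refine ⟨hcont, fun U f _ hf x hx => ?_⟩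
  obtain ⟨N, hN, hxN, hNU, c'', hc'', hNc, a, ha, b, hb, hab⟩ := hf (F x) hx
  obtain ⟨c, hc, h⟩ := H' x
  have h := h c'' hc'' (hNc hxN)
  obtain ⟨p, hp, q, hq, hq0, hpq⟩ := mul_mem (h.ring_mem ha)
    (inv_mem_localRing h.mem_dom (h.ring_mem hb) (hab _ hxN).1)
  let := A.zariski
  let := B.zariski
  refine ⟨F ⁻¹' N ∩ c.basicOpen q, (hN.preimage hcont).inter (A.isOpen_basicOpen hc hq),
    ⟨hxN, h.mem_dom, hq0⟩, fun y hy => hNU hy.1, c, hc, fun y hy => hy.2.1, p, hp, q, hq,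
    fun y hy => ⟨hy.2.2, ?_⟩⟩
  rw [← hpq y hy.2, Function.comp_apply, (hab _ hy.1).2, div_eq_mul_inv]
  rfl

end AlgAtlas
end

noncomputable section

/-! ## Vector-valued regular functions -/

section RegVec

variable {X : Type*} {R : Subalgebra ℂ (X → ℂ)}
variable {E E₁ E₂ : Type*} [AddCommGroup E] [Module ℂ E] [AddCommGroup E₁] [Module ℂ E₁]
  [AddCommGroup E₂] [Module ℂ E₂]

/-- A vector-valued function all of whose coordinates belong to a given algebra of functions. -/
def IsRegVec (R : Subalgebra ℂ (X → ℂ)) (F : X → E) : Prop :=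
  ∀ φ : Module.Dual ℂ E, (fun y => φ (F y)) ∈ R

namespace IsRegVec

lemma const (e : E) : IsRegVec R fun _ => e := fun φ => R.algebraMap_mem (φ e)

lemma of_mem {f : X → ℂ} (hf : f ∈ R) : IsRegVec R f := fun φ => by
  have h : (fun y => φ (f y)) = f * algebraMap ℂ (X → ℂ) (φ 1) := by
    ext y
    conv_lhs => rw [← mul_one (f y), ← smul_eq_mul, map_smul]
    rfl
  rw [h]
  exact R.mul_mem hf (R.algebraMap_mem _)

lemma add {F G : X → E} (hF : IsRegVec R F) (hG : IsRegVec R G) : IsRegVec R fun y => F y + G y :=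
  fun φ => by simp only [map_add]; exact R.add_mem (hF φ) (hG φ)

lemma sub {F G : X → E} (hF : IsRegVec R F) (hG : IsRegVec R G) : IsRegVec R fun y => F y - G y :=
  fun φ => by simp only [map_sub]; exact R.sub_mem (hF φ) (hG φ)

lemma smul {f : X → ℂ} {F : X → E} (hf : f ∈ R) (hF : IsRegVec R F) :
    IsRegVec R fun y => f y • F y :=
  fun φ => by simp only [map_smul, smul_eq_mul]; exact R.mul_mem hf (hF φ)

lemma sum {ι : Type*} {s : Finset ι} {F : ι → X → E} (hF : ∀ i ∈ s, IsRegVec R (F i)) :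
    IsRegVec R fun y => ∑ i ∈ s, F i y := fun φ => by
  have := R.sum_mem fun i hi => hF i hi φ
  convert this using 1
  ext y
  simp

lemma map {F : X → E} (hF : IsRegVec R F) (l : E →ₗ[ℂ] E₁) : IsRegVec R fun y => l (F y) :=
  fun φ => hF (φ ∘ₗ l)

/-- Expanding the first argument in a basis leaves a finite sum of scalar functions times fixed
linear images of `G`. -/
lemma bilin [FiniteDimensional ℂ E] {F : X → E} {G : X → E₁} (hF : IsRegVec R F)
    (hG : IsRegVec R G) (β : E →ₗ[ℂ] E₁ →ₗ[ℂ] E₂) : IsRegVec R fun y => β (F y) (G y) := by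
  let b := Module.finBasis ℂ E
  have h : (fun y => β (F y) (G y)) = fun y => ∑ i, b.coord i (F y) • β (b i) (G y) := by
    ext y
    conv_lhs => rw [← b.sum_repr (F y)]
    simp only [map_sum, LinearMap.sum_apply, map_smul, LinearMap.smul_apply,
      Module.Basis.coord_apply]
  rw [h]
  exact sum fun i _ => smul (hF _) (hG.map _)

lemma comp [FiniteDimensional ℂ E] [FiniteDimensional ℂ E₁] [FiniteDimensional ℂ E₂]
    {F : X → E₁ →ₗ[ℂ] E₂} {G : X → E →ₗ[ℂ] E₁} (hF : IsRegVec R F) (hG : IsRegVec R G) :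
    IsRegVec R fun y => F y ∘ₗ G y :=
  hF.bilin hG (LinearMap.llcomp ℂ E E₁ E₂)

lemma apply [FiniteDimensional ℂ E] [FiniteDimensional ℂ E₁]
    {F : X → E →ₗ[ℂ] E₁} {G : X → E} (hF : IsRegVec R F) (hG : IsRegVec R G) :
    IsRegVec R fun y => F y (G y) :=
  hF.bilin hG LinearMap.id

/-- Maps of rank one built from two bases span the Hom space, so matrix entries control every
functional on it. This is how the coordinates of a Grassmannian chart enter. -/
lemma of_entries [FiniteDimensional ℂ E] [FiniteDimensional ℂ E₁] {F : X → E →ₗ[ℂ] E₁}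
    (h : ∀ (φ : Module.Dual ℂ E₁) (t : E), (fun y => φ (F y t)) ∈ R) : IsRegVec R F := by
  let b := Module.finBasis ℂ E
  let b' := Module.finBasis ℂ E₁
  have h' : F = fun y => ∑ i, ∑ j, b'.coord j (F y (b i)) • (b.coord i).smulRight (b' j) := by
    ext y t
    conv_lhs => rw [← b.sum_repr t]
    simp only [map_sum, map_smul, LinearMap.sum_apply, LinearMap.smul_apply,
      LinearMap.smulRight_apply, Module.Basis.coord_apply]
    refine Finset.sum_congr rfl fun i _ => ?_
    conv_lhs => rw [← b'.sum_repr (F y (b i)), Finset.smul_sum]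
    exact Finset.sum_congr rfl fun j _ => smul_comm _ _ _
  rw [h']
  exact sum fun i _ => sum fun j _ => smul (h _ _) (const _)

lemma pi {J : Type*} [Fintype J] {E : J → Type*} [∀ j, AddCommGroup (E j)]
    [∀ j, Module ℂ (E j)] {F : X → ∀ j, E j} (hF : ∀ j, IsRegVec R fun y => F y j) :
    IsRegVec R F := by
  classical
  have h : F = fun y => ∑ j, LinearMap.single ℂ E j (F y j) := by
    ext y j
    simp [Finset.sum_apply]
  rw [h]
  exact sum fun j _ => (hF j).map _

lemma prod {F : X → E} {G : X → E₁} (hF : IsRegVec R F) (hG : IsRegVec R G) :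
    IsRegVec R fun y => (F y, G y) := by
  have h : (fun y => (F y, G y)) =
      fun y => LinearMap.inl ℂ E E₁ (F y) + LinearMap.inr ℂ E E₁ (G y) := by ext y <;> simp
  rw [h]
  exact (hF.map _).add (hG.map _)

/-! ### Determinants and inverses of regular families of endomorphisms. -/

section Matrix

variable {n : Type*} [Fintype n] [DecidableEq n]

/-- A matrix of functions in an algebra, evaluated at a point. -/
lemma det_adjugate_mem {M : X → Matrix n n ℂ} (hM : ∀ i j, (fun y => M y i j) ∈ R) :
    (fun y => (M y).det) ∈ R ∧ ∀ i j, (fun y => (M y).adjugate i j) ∈ R := by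
  -- Over the commutative ring `R` the family is a single matrix; determinant and adjugate commute
  -- with evaluation at a point.
  let N : Matrix n n R := fun i j => ⟨fun y => M y i j, hM i j⟩
  let ev (y : X) : R →+* ℂ := (Pi.evalRingHom _ y).comp R.subtype
  have hN (y) : (ev y).mapMatrix N = M y := rfl
  constructor
  · convert N.det.2 using 1
    ext y
    rw [← hN, ← RingHom.map_det]
    rfl
  · intro i j
    convert (N.adjugate i j).2 using 1
    ext y
    rw [← hN, ← RingHom.map_adjugate]
    rfl

end Matrix

lemma det [FiniteDimensional ℂ E] {F : X → Module.End ℂ E} (hF : IsRegVec R F) :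
    (fun y => LinearMap.det (F y)) ∈ R := by
  let b := Module.finBasis ℂ E
  have := (det_adjugate_mem (R := R) (M := fun y => LinearMap.toMatrix b b (F y)) fun i j => by
    simp only [LinearMap.toMatrix_apply]
    exact hF.map (LinearMap.applyₗ (b j)) (b.coord i)).1
  simpa only [LinearMap.det_toMatrix] using this

/-- Cramer's rule. Where the determinant vanishes, `Ring.inverse` and the scalar inverse are both
zero, so the formula holds at every point. -/
lemma inverse [FiniteDimensional ℂ E] {F : X → Module.End ℂ E} (hF : IsRegVec R F)
    (hd : (fun y => LinearMap.det (F y))⁻¹ ∈ R) : IsRegVec R fun y => Ring.inverse (F y) := by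
  let b := Module.finBasis ℂ E
  have hM := (det_adjugate_mem (R := R) (M := fun y => LinearMap.toMatrix b b (F y)) fun i j => by
    simp only [LinearMap.toMatrix_apply]
    exact hF.map (LinearMap.applyₗ (b j)) (b.coord i)).2
  have h : (fun y => Ring.inverse (F y)) = fun y => (LinearMap.det (F y))⁻¹ •
      Matrix.toLin b b (LinearMap.toMatrix b b (F y)).adjugate := by
    ext1 y
    by_cases hy : LinearMap.det (F y) = 0
    · rw [hy, inv_zero, zero_smul, Ring.inverse_non_unit]
      rwa [LinearMap.isUnit_iff_isUnit_det, isUnit_iff_ne_zero, not_not]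
    · have hu : IsUnit (F y) := by
        rwa [LinearMap.isUnit_iff_isUnit_det, isUnit_iff_ne_zero]
      rw [← mul_one (Ring.inverse (F y)), Ring.inverse_mul_eq_iff_eq_mul _ _ _ hu, mul_smul_comm]
      have : F y * Matrix.toLin b b (LinearMap.toMatrix b b (F y)).adjugate =
          LinearMap.det (F y) • 1 := by
        apply (LinearMap.toMatrix b b).injective
        rw [Module.End.mul_eq_comp, LinearMap.toMatrix_comp b b b, LinearMap.toMatrix_toLin,
          Matrix.mul_adjugate, LinearMap.det_toMatrix, map_smul, LinearMap.toMatrix_one]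
      rw [this, smul_smul, inv_mul_cancel₀ hy, one_smul]
  rw [h]
  refine smul hd (of_entries fun φ t => ?_)
  simp only [Matrix.toLin_apply, Matrix.mulVec, dotProduct, map_sum, map_smul, smul_eq_mul]
  have : (fun y => ∑ i, (∑ j, (LinearMap.toMatrix b b (F y)).adjugate i j * b.repr t j) *
      φ (b i)) = ∑ i, (∑ j, (fun y => (LinearMap.toMatrix b b (F y)).adjugate i j) *
        algebraMap ℂ (X → ℂ) (b.repr t j)) * algebraMap ℂ (X → ℂ) (φ (b i)) := by
    ext y
    simp [Finset.sum_apply]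
  rw [this]
  exact R.sum_mem fun i _ => R.mul_mem (R.sum_mem fun j _ => R.mul_mem (hM i j)
    (R.algebraMap_mem _)) (R.algebraMap_mem _)

end IsRegVec

end RegVec

/-! ## The Grassmannian atlas is compatible -/

section Grassmann

variable {E : Type*} [AddCommGroup E] [Module ℂ E] {U C : Submodule ℂ E}

lemma projAlong_mem (h : IsCompl U C) (t : E) : projAlong U C t ∈ U := by
  rw [projAlong, dif_pos h]
  exact Submodule.projection_apply_mem h t

lemma sub_projAlong_mem (h : IsCompl U C) (t : E) : t - projAlong U C t ∈ C := by
  rw [projAlong, dif_pos h]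
  exact Submodule.sub_projection_mem h t

lemma eq_of_sub_mem_of_isCompl (h : IsCompl U C) {a b : E} (ha : a ∈ U) (hb : b ∈ U)
    (hab : a - b ∈ C) : a = b :=
  sub_eq_zero.1 (Submodule.disjoint_def.1 h.disjoint _ (U.sub_mem ha hb) hab)

lemma projAlong_eq (h : IsCompl U C) {t s : E} (hs : s ∈ U) (hts : t - s ∈ C) :
    projAlong U C t = s :=
  eq_of_sub_mem_of_isCompl h (projAlong_mem h t) hs (by
    simpa using C.sub_mem hts (sub_projAlong_mem h t))

lemma projAlong_of_mem (h : IsCompl U C) {t : E} (ht : t ∈ U) : projAlong U C t = t :=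
  projAlong_eq h ht (by simp)

lemma projAlong_of_mem_right (h : IsCompl U C) {t : E} (ht : t ∈ C) : projAlong U C t = 0 :=
  projAlong_eq h U.zero_mem (by simpa using ht)

lemma mem_of_projAlong_eq_zero (h : IsCompl U C) {t : E} (ht : projAlong U C t = 0) : t ∈ C := by
  simpa [ht] using sub_projAlong_mem h t

lemma mem_iff_projAlong_eq (h : IsCompl U C) {t : E} : t ∈ U ↔ projAlong U C t = t :=
  ⟨projAlong_of_mem h, fun ht => ht ▸ projAlong_mem h t⟩

/-- Change of the complement in a Grassmannian chart. -/
lemma isCompl_and_projAlong_eq {U₀ C' : Submodule ℂ E} (h₀ : IsCompl U₀ C) (h₀' : IsCompl U₀ C')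
    (h : IsCompl U C)
    (hu : IsUnit (projAlong U₀ C' * projAlong U C * projAlong U₀ C + (1 - projAlong U₀ C))) :
    IsCompl U C' ∧ projAlong U C' = projAlong U C * Ring.inverse
      (projAlong U₀ C' * projAlong U C * projAlong U₀ C + (1 - projAlong U₀ C)) *
        projAlong U₀ C' := by
  set G := projAlong U₀ C' * projAlong U C * projAlong U₀ C + (1 - projAlong U₀ C) with hG
  have hGa (w : E) : G w = projAlong U₀ C' (projAlong U C (projAlong U₀ C w)) +
      (w - projAlong U₀ C w) := by simp [hG]
  -- The point of U congruent to v modulo C' is the projection to U, along C, of the w ∈ U₀ that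
  -- solves P₀' P w = P₀' v. `G` extends this system from U₀ to E by the identity on C, so that its
  -- inverse produces w.
  have key (v : E) : v - projAlong U C (Ring.inverse G (projAlong U₀ C' v)) ∈ C' := by
    set w := Ring.inverse G (projAlong U₀ C' v)
    have hGw : G w = projAlong U₀ C' v :=
      LinearMap.congr_fun (Ring.mul_inverse_cancel G hu) (projAlong U₀ C' v)
    have hw : w - projAlong U₀ C w = 0 := by
      refine Submodule.disjoint_def.1 h₀.disjoint _ ?_ (sub_projAlong_mem h₀ w)
      have : w - projAlong U₀ C w =
          projAlong U₀ C' v - projAlong U₀ C' (projAlong U C (projAlong U₀ C w)) := by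
        rw [← hGw, hGa]
        abel
      rw [this]
      exact U₀.sub_mem (projAlong_mem h₀' _) (projAlong_mem h₀' _)
    rw [hGa, hw, add_zero, ← sub_eq_zero.1 hw] at hGw
    apply mem_of_projAlong_eq_zero h₀'
    rw [map_sub, hGw, sub_self]
  have hcompl : IsCompl U C' := by
    constructor
    · rw [Submodule.disjoint_def]
      intro t ht ht'
      have h1 : projAlong U C (projAlong U₀ C t) = t := projAlong_eq h ht (by
        rw [← Submodule.neg_mem_iff, neg_sub]
        exact sub_projAlong_mem h₀ t)
      have h2 : G (projAlong U₀ C t) = 0 := by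
        rw [hGa, projAlong_of_mem h₀ (projAlong_mem h₀ t), h1, projAlong_of_mem_right h₀' ht',
          sub_self, add_zero]
      have h3 : projAlong U₀ C t = 0 := by
        have := LinearMap.congr_fun (Ring.inverse_mul_cancel G hu) (projAlong U₀ C t)
        rw [Module.End.mul_apply, h2, map_zero] at this
        exact this.symm
      rw [← h1, h3, map_zero]
    · rw [codisjoint_iff, eq_top_iff]
      intro v _
      rw [← sub_add_cancel v (projAlong U C (Ring.inverse G (projAlong U₀ C' v))), add_comm]
      exact Submodule.add_mem_sup (projAlong_mem h _) (key v)
  exact ⟨hcompl, LinearMap.ext fun v => projAlong_eq hcompl (projAlong_mem h _) (key v)⟩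

/-- The standard chart of the Grassmannian belonging to a subspace. -/
def grassmannChart (C : Submodule ℂ E) : AlgChart (Submodule ℂ E) :=
  ⟨{U | IsCompl U C}, {a | ∃ (φ : Module.Dual ℂ E) (t : E), a = fun U => φ (projAlong U C t)}⟩

lemma grassmannChart_mem (C : Submodule ℂ E) : grassmannChart C ∈ (grassmannAtlas E).charts :=
  ⟨C, rfl⟩

/-- Near U₀ the projection along C' is a rational expression in the projection along C, whose
denominator is a determinant with value 1 at U₀. -/
lemma isCompatible_grassmannAtlas [FiniteDimensional ℂ E] : (grassmannAtlas E).IsCompatible := by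
  rintro _ ⟨C, rfl⟩ _ ⟨C', rfl⟩ U₀ (h₀ : IsCompl U₀ C) (h₀' : IsCompl U₀ C')
  change AlgChart.ChartMap (grassmannChart C) (grassmannChart C') id U₀
  set R := (grassmannChart C).localRing U₀
  have hmem : U₀ ∈ (grassmannChart C).dom := h₀
  have hP : IsRegVec R fun U => projAlong U C := IsRegVec.of_entries fun φ t =>
    AlgChart.ring_le_localRing _ _ (AlgChart.coord_mem_ring ⟨φ, t, rfl⟩)
  let G (U : Submodule ℂ E) : Module.End ℂ E :=
    projAlong U₀ C' * projAlong U C * projAlong U₀ C + (1 - projAlong U₀ C)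
  have hG : IsRegVec R G := ((((IsRegVec.const _).comp hP).comp (.const _)).add (.const _))
  have hG₀ : G U₀ = 1 := by
    ext t
    simp only [G, LinearMap.add_apply, Module.End.mul_apply, LinearMap.sub_apply,
      Module.End.one_apply]
    rw [projAlong_of_mem h₀ (projAlong_mem h₀ t), projAlong_of_mem h₀' (projAlong_mem h₀ t)]
    abel
  have hd : LinearMap.det (G U₀) ≠ 0 := by
    rw [hG₀, map_one]
    exact one_ne_zero
  obtain ⟨h, hh, hh0, hne⟩ := AlgChart.exists_basicOpen_ne_zero hmem hG.det hd
  have hs (U) (hU : U ∈ (grassmannChart C).basicOpen h) :=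
    isCompl_and_projAlong_eq h₀ h₀' hU.1 (U := U) (by
      rw [LinearMap.isUnit_iff_isUnit_det, isUnit_iff_ne_zero]
      exact hne U hU)
  refine ⟨hmem, ⟨h, hh, hh0, fun U hU => (hs U hU).1⟩, ?_⟩
  rintro _ ⟨φ, t, rfl⟩
  have hreg : IsRegVec R fun U => projAlong U C * Ring.inverse (G U) * projAlong U₀ C' :=
    (hP.comp (hG.inverse (AlgChart.inv_mem_localRing hmem hG.det hd))).comp (.const _)
  refine AlgChart.localRing_congr (hreg.map (LinearMap.applyₗ t) φ) hh hh0 fun U hU => ?_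
  simp only [Function.comp_apply, id, (hs U hU).2]
  rfl

end Grassmann
end

noncomputable section

/-! ## Subspaces of a direct sum as graphs -/

section Graph

variable {X Y S : Type*} [AddCommGroup X] [Module ℂ X] [AddCommGroup Y] [Module ℂ Y]
  [AddCommGroup S] [Module ℂ S]

/-- `Y` is the direct sum of `X` and `S`, with inclusions `ι`, `σ` and projections `ρ`, `π`. -/
structure IsDirectSum (ι : X →ₗ[ℂ] Y) (ρ : Y →ₗ[ℂ] X) (π : Y →ₗ[ℂ] S) (σ : S →ₗ[ℂ] Y) :
    Prop where
  proj_inl : ∀ x, ρ (ι x) = x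
  proj_inr : ∀ s, π (σ s) = s
  sum_eq : ∀ y, ι (ρ y) + σ (π y) = y

/-- The subspace of all `y` with `π y ∈ B` and `ρ y ∈ H (π y) + A`. -/
def graphSubmodule (ρ : Y →ₗ[ℂ] X) (π : Y →ₗ[ℂ] S) (A : Submodule ℂ X) (B : Submodule ℂ S)
    (H : S →ₗ[ℂ] X) : Submodule ℂ Y :=
  B.comap π ⊓ A.comap (ρ - H ∘ₗ π)

variable {ι : X →ₗ[ℂ] Y} {ρ : Y →ₗ[ℂ] X} {π : Y →ₗ[ℂ] S} {σ : S →ₗ[ℂ] Y}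
  {A C : Submodule ℂ X} {B D : Submodule ℂ S} {H : S →ₗ[ℂ] X} {U : Submodule ℂ Y}

lemma mem_graphSubmodule {y : Y} :
    y ∈ graphSubmodule ρ π A B H ↔ π y ∈ B ∧ ρ y - H (π y) ∈ A := Iff.rfl

lemma mem_graphSubmodule_zero {y : Y} :
    y ∈ graphSubmodule ρ π A B 0 ↔ π y ∈ B ∧ ρ y ∈ A := by
  rw [mem_graphSubmodule, LinearMap.zero_apply, sub_zero]

namespace IsDirectSum

variable (h : IsDirectSum ι ρ π σ)
include h

lemma π_ι (x : X) : π (ι x) = 0 := by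
  have h1 := h.sum_eq (ι x)
  rw [h.proj_inl, add_eq_left] at h1
  rw [← h.proj_inr (π (ι x)), h1, map_zero]

lemma ρ_σ (s : S) : ρ (σ s) = 0 := by
  have h1 := h.sum_eq (σ s)
  rw [h.proj_inr, add_eq_right] at h1
  rw [← h.proj_inl (ρ (σ s)), h1, map_zero]

lemma eq_zero {y : Y} (h1 : ρ y = 0) (h2 : π y = 0) : y = 0 := by
  rw [← h.sum_eq y, h1, h2, map_zero, map_zero, add_zero]

lemma comap_graphSubmodule : (graphSubmodule ρ π A B H).comap ι = A := by
  ext x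
  simp [mem_graphSubmodule, h.π_ι, h.proj_inl]

lemma add_mem_graphSubmodule {s : S} (hs : s ∈ B) : σ s + ι (H s) ∈ graphSubmodule ρ π A B H := by
  simp [mem_graphSubmodule, h.π_ι, h.proj_inl, h.proj_inr, h.ρ_σ, hs]

lemma map_graphSubmodule : (graphSubmodule ρ π A B H).map π = B := by
  ext s
  constructor
  · rintro ⟨y, hy, rfl⟩
    exact hy.1
  · intro hs
    exact ⟨_, h.add_mem_graphSubmodule hs, by simp [h.π_ι, h.proj_inr]⟩

/-- The complement C ⊕ D does not involve `H`, so one Grassmannian chart contains all graphs over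
(A, B). The explicit projection is polynomial in the data, which makes the inverse trivialization
regular. -/
lemma isCompl_graphSubmodule (hA : IsCompl A C) (hB : IsCompl B D) :
    IsCompl (graphSubmodule ρ π A B H) (graphSubmodule ρ π C D 0) ∧
    ∀ y, projAlong (graphSubmodule ρ π A B H) (graphSubmodule ρ π C D 0) y =
      σ (projAlong B D (π y)) + ι (H (projAlong B D (π y)) +
        projAlong A C (ρ y - H (projAlong B D (π y)))) := by
  set P := fun y => σ (projAlong B D (π y)) + ι (H (projAlong B D (π y)) +
        projAlong A C (ρ y - H (projAlong B D (π y)))) with hP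
  have h1 (y) : P y ∈ graphSubmodule ρ π A B H := by
    simp only [mem_graphSubmodule, hP, map_add, h.π_ι, h.proj_inl, h.proj_inr, h.ρ_σ, zero_add,
      add_zero, add_sub_cancel_left]
    exact ⟨projAlong_mem hB _, projAlong_mem hA _⟩
  have h2 (y) : y - P y ∈ graphSubmodule ρ π C D 0 := by
    simp only [mem_graphSubmodule_zero, hP, map_sub ρ, map_sub π, map_add ρ, map_add π, h.π_ι,
      h.proj_inl, h.proj_inr, h.ρ_σ, zero_add, add_zero]
    refine ⟨sub_projAlong_mem hB _, ?_⟩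
    have := sub_projAlong_mem hA (ρ y - H (projAlong B D (π y)))
    rwa [sub_sub] at this
  have hc : IsCompl (graphSubmodule ρ π A B H) (graphSubmodule ρ π C D 0) := by
    constructor
    · rw [Submodule.disjoint_def]
      intro y hy hy'
      rw [mem_graphSubmodule] at hy
      rw [mem_graphSubmodule_zero] at hy'
      have h3 : π y = 0 := Submodule.disjoint_def.1 hB.disjoint _ hy.1 hy'.1
      rw [h3, map_zero, sub_zero] at hy
      exact h.eq_zero (Submodule.disjoint_def.1 hA.disjoint _ hy.2 hy'.2) h3
    · rw [codisjoint_iff, eq_top_iff]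
      intro y _
      rw [← add_sub_cancel (P y) y]
      exact Submodule.add_mem_sup (h1 y) (h2 y)
  exact ⟨hc, fun y => projAlong_eq hc (h1 y) (h2 y)⟩

lemma isCompl_of_comap_of_map (hU : U.comap ι = A) (hU' : U.map π = B) (hA : IsCompl A C)
    (hB : IsCompl B D) : IsCompl U (graphSubmodule ρ π C D 0) := by
  constructor
  · rw [Submodule.disjoint_def]
    intro y hy hy'
    rw [mem_graphSubmodule_zero] at hy'
    have h3 : π y = 0 := Submodule.disjoint_def.1 hB.disjoint _
      (hU' ▸ Submodule.mem_map_of_mem hy) hy'.1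
    have h4 : ι (ρ y) = y := by
      have := h.sum_eq y
      rwa [h3, map_zero, add_zero] at this
    refine h.eq_zero (Submodule.disjoint_def.1 hA.disjoint _ ?_ hy'.2) h3
    rw [← hU, Submodule.mem_comap, h4]
    exact hy
  · rw [codisjoint_iff, eq_top_iff]
    intro y _
    obtain ⟨u, hu, hub⟩ : projAlong B D (π y) ∈ U.map π := by
      rw [hU']
      exact projAlong_mem hB _
    have ha : projAlong A C (ρ (y - u)) ∈ U.comap ι := by
      rw [hU]
      exact projAlong_mem hA _
    -- The element u of U matches y in S modulo D; adding an element of A matches it in X modulo C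
    -- without disturbing S.
    rw [← add_sub_cancel (u + ι (projAlong A C (ρ (y - u)))) y]
    refine Submodule.add_mem_sup (U.add_mem hu ha) ?_
    rw [mem_graphSubmodule_zero, ← sub_sub]
    constructor
    · rw [map_sub π, h.π_ι, sub_zero, map_sub, hub]
      exact sub_projAlong_mem hB _
    · rw [map_sub ρ, h.proj_inl]
      exact sub_projAlong_mem hA _

/-- The diagonal entries of the projection to U are the projections to A and B (see also
`projAlong_σ`), so the coordinates of A and B are coordinates of U. -/
lemma projAlong_ι (hU : U.comap ι = A) (hA : IsCompl A C)
    (hc : IsCompl U (graphSubmodule ρ π C D 0)) (x : X) :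
    ρ (projAlong U (graphSubmodule ρ π C D 0) (ι x)) = projAlong A C x := by
  have ha : ι (projAlong A C x) ∈ U := by
    rw [← Submodule.mem_comap, hU]
    exact projAlong_mem hA x
  rw [projAlong_eq hc ha, h.proj_inl]
  rw [mem_graphSubmodule_zero, ← map_sub, h.π_ι, h.proj_inl]
  exact ⟨D.zero_mem, sub_projAlong_mem hA x⟩

lemma projAlong_σ (hU' : U.map π = B) (hB : IsCompl B D)
    (hc : IsCompl U (graphSubmodule ρ π C D 0)) (s : S) :
    π (projAlong U (graphSubmodule ρ π C D 0) (σ s)) = projAlong B D s := by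
  refine (projAlong_eq hB (hU' ▸ Submodule.mem_map_of_mem (projAlong_mem hc _)) ?_).symm
  have := (mem_graphSubmodule_zero.1 (sub_projAlong_mem hc (σ s))).1
  rwa [map_sub, h.proj_inr] at this

/-- The matrix entry `S → X` of the projection to a subspace determines the subspace, given its
intersection with `X` and its image in `S`. -/
lemma eq_graphSubmodule (hU : U.comap ι = A) (hU' : U.map π = B) (hA : IsCompl A C)
    (hB : IsCompl B D) :
    U = graphSubmodule ρ π A B (ρ ∘ₗ projAlong U (graphSubmodule ρ π C D 0) ∘ₗ σ) := by
  have hc := h.isCompl_of_comap_of_map hU hU' hA hB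
  set P := projAlong U (graphSubmodule ρ π C D 0) with hP
  have hle : U ≤ graphSubmodule ρ π A B (ρ ∘ₗ P ∘ₗ σ) := by
    intro u hu
    have hb : π u ∈ B := hU' ▸ Submodule.mem_map_of_mem hu
    refine mem_graphSubmodule.2 ⟨hb, ?_⟩
    have hw : u - P (σ (π u)) ∈ U := U.sub_mem hu (projAlong_mem hc _)
    have h3 : π (u - P (σ (π u))) = 0 := by
      rw [map_sub, h.projAlong_σ hU' hB hc, projAlong_of_mem hB hb, sub_self]
    have h4 := h.sum_eq (u - P (σ (π u)))
    rw [h3, map_zero, add_zero] at h4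
    rw [LinearMap.comp_apply, LinearMap.comp_apply, ← map_sub, ← hU, Submodule.mem_comap, h4]
    exact hw
  -- Both subspaces are complementary to C ⊕ D, so the inclusion is an equality.
  refine le_antisymm hle fun y hy => ?_
  have h5 := Submodule.disjoint_def.1
    (h.isCompl_graphSubmodule (H := ρ ∘ₗ P ∘ₗ σ) hA hB).1.disjoint (y - P y)
    (Submodule.sub_mem _ hy (hle (projAlong_mem hc y))) (sub_projAlong_mem hc y)
  rw [sub_eq_zero.1 h5]
  exact projAlong_mem hc y

/-- Only the induced map from B to X / A is visible in the graph; the entry is its representative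
that vanishes on D and takes values in C. -/
lemma entry_graphSubmodule (hA : IsCompl A C) (hB : IsCompl B D) :
    ρ ∘ₗ projAlong (graphSubmodule ρ π A B H) (graphSubmodule ρ π C D 0) ∘ₗ σ =
      (1 - projAlong A C) ∘ₗ H ∘ₗ projAlong B D := by
  ext s
  simp only [LinearMap.comp_apply, (h.isCompl_graphSubmodule hA hB).2, map_add, h.ρ_σ, h.proj_inl,
    h.proj_inr, zero_sub, zero_add, map_neg, LinearMap.sub_apply, Module.End.one_apply]
  abel

/-- Complementarity of U to C ⊕ D gives only this half for the intersection, and only the other half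
for the image (`codisjoint_map`). The missing halves come from the fixed dimension vectors, which is
why f and g must be fixed for the map to be regular. -/
lemma disjoint_comap (hc : IsCompl U (graphSubmodule ρ π C D 0)) : Disjoint (U.comap ι) C := by
  rw [Submodule.disjoint_def]
  intro x hx hx'
  have h1 : ι x ∈ graphSubmodule ρ π C D 0 := by
    rw [mem_graphSubmodule_zero, h.π_ι, h.proj_inl]
    exact ⟨D.zero_mem, hx'⟩
  rw [← h.proj_inl x, Submodule.disjoint_def.1 hc.disjoint _ hx h1, map_zero]

lemma codisjoint_map (hc : IsCompl U (graphSubmodule ρ π C D 0)) : Codisjoint (U.map π) D := by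
  rw [codisjoint_iff, eq_top_iff]
  intro s _
  rw [← h.proj_inr s, ← add_sub_cancel (projAlong U (graphSubmodule ρ π C D 0) (σ s)) (σ s),
    map_add]
  exact Submodule.add_mem_sup (Submodule.mem_map_of_mem (projAlong_mem hc _))
    (mem_graphSubmodule_zero.1 (sub_projAlong_mem hc _)).1

end IsDirectSum

/-- Turns a condition on moving subspaces into a linear equation on `H` with coefficients regular in
the subspaces. -/
lemma sandwich_eq_zero_iff {A C : Submodule ℂ X} {B D : Submodule ℂ S} (hA : IsCompl A C)
    (hB : IsCompl B D) (H : S →ₗ[ℂ] X) :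
    (1 - projAlong A C) ∘ₗ H ∘ₗ projAlong B D = 0 ↔ ∀ s ∈ B, H s ∈ A := by
  constructor
  · intro h s hs
    have := LinearMap.congr_fun h s
    simp only [LinearMap.comp_apply, LinearMap.sub_apply, Module.End.one_apply,
      LinearMap.zero_apply, projAlong_of_mem hB hs, sub_eq_zero] at this
    exact (mem_iff_projAlong_eq hA).2 this.symm
  · intro h
    ext s
    simp only [LinearMap.comp_apply, LinearMap.sub_apply, Module.End.one_apply,
      LinearMap.zero_apply, projAlong_of_mem hA (h _ (projAlong_mem hB s)), sub_self]

lemma isCompl_of_disjoint_of_finrank_eq [FiniteDimensional ℂ X] {A A' C : Submodule ℂ X}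
    (hd : Disjoint A C) (hA' : IsCompl A' C)
    (h : Module.finrank ℂ A = Module.finrank ℂ A') : IsCompl A C := by
  refine ⟨hd, codisjoint_iff.2 (Submodule.eq_top_of_finrank_eq ?_)⟩
  have h1 := Submodule.finrank_sup_add_finrank_inf_eq A C
  rw [hd.eq_bot, finrank_bot, add_zero, h] at h1
  rw [h1, Submodule.finrank_add_eq_of_isCompl hA']

lemma isCompl_of_codisjoint_of_finrank_eq [FiniteDimensional ℂ X] {A A' C : Submodule ℂ X}
    (hd : Codisjoint A C) (hA' : IsCompl A' C)
    (h : Module.finrank ℂ A = Module.finrank ℂ A') : IsCompl A C := by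
  refine ⟨disjoint_iff.2 (Submodule.finrank_eq_zero.1 ?_), hd⟩
  have h1 := Submodule.finrank_sup_add_finrank_inf_eq A C
  rw [codisjoint_iff.1 hd, finrank_top, h, ← Submodule.finrank_add_eq_of_isCompl hA'] at h1
  omega

/-- Every linear map over a field has a generalized inverse. -/
lemma exists_generalized_inverse (T : X →ₗ[ℂ] Y) : ∃ R : Y →ₗ[ℂ] X, T ∘ₗ R ∘ₗ T = T := by
  obtain ⟨s, hs⟩ := T.rangeRestrict.exists_rightInverse_of_surjective T.range_rangeRestrict
  obtain ⟨q, hq⟩ := (LinearMap.range T).subtype.exists_leftInverse_of_injective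
    (Submodule.ker_subtype _)
  refine ⟨s ∘ₗ q, LinearMap.ext fun x => ?_⟩
  have h1 : q (T x) = T.rangeRestrict x := LinearMap.congr_fun hq (T.rangeRestrict x)
  have h2 := congrArg Subtype.val (LinearMap.congr_fun hs (T.rangeRestrict x))
  rw [LinearMap.comp_apply, LinearMap.comp_apply, LinearMap.comp_apply, h1]
  exact h2

/-- A small deformation `T` of `T₀` with kernel of the same dimension: the kernels are identified
by `1 + R ∘ (T - T₀)`, for a generalized inverse `R` of `T₀`. -/
lemma inverse_mem_ker [FiniteDimensional ℂ X] {T₀ T : X →ₗ[ℂ] Y} {R : Y →ₗ[ℂ] X}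
    (hR : T₀ ∘ₗ R ∘ₗ T₀ = T₀)
    (hf : Module.finrank ℂ (LinearMap.ker T) = Module.finrank ℂ (LinearMap.ker T₀))
    (hu : IsUnit (1 + R ∘ₗ (T - T₀) : Module.End ℂ X)) {k : X} (hk : k ∈ LinearMap.ker T₀) :
    Ring.inverse (1 + R ∘ₗ (T - T₀) : Module.End ℂ X) k ∈ LinearMap.ker T := by
  set G : Module.End ℂ X := 1 + R ∘ₗ (T - T₀) with hG
  have hinv (x : X) : Ring.inverse G (G x) = x :=
    LinearMap.congr_fun (Ring.inverse_mul_cancel G hu) x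
  -- On the kernel of T the map G is 1 − R T₀, which T₀ kills because T₀ R T₀ = T₀. Injectivity of G
  -- and equal dimensions then give equality.
  have hle : (LinearMap.ker T).map G ≤ LinearMap.ker T₀ := by
    rintro _ ⟨x, hx, rfl⟩
    have h1 : T₀ (R (T₀ x)) = T₀ x := LinearMap.congr_fun hR x
    have hx : T x = 0 := hx
    simp [hG, hx, h1]
  have heq : (LinearMap.ker T).map G = LinearMap.ker T₀ := by
    refine Submodule.eq_of_le_of_finrank_eq hle ?_
    rw [← hf]
    exact (Submodule.equivMapOfInjective G (Function.LeftInverse.injective hinv)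
      _).finrank_eq.symm
  rw [← heq] at hk
  obtain ⟨x, hx, rfl⟩ := hk
  rwa [hinv]

end Graph
end

noncomputable section

/-! ## Homomorphisms from a subrepresentation to a quotient representation -/

namespace QRep

variable {W : Type u} [Quiver.{v} W]

/-- Families of linear maps at all vertices. -/
abbrev HomFamily (S X : QRep.{u, v, w} W) : Type (max u w) := ∀ x : W, S.sp x →ₗ[ℂ] X.sp x

/-- Families of linear maps along all arrows. -/
abbrev ArrowFamily (S X : QRep.{u, v, w} W) : Type (max u v w) :=
  ∀ b : (Σ x y : W, x ⟶ y), S.sp b.1 →ₗ[ℂ] X.sp b.2.1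

/-- The obstruction to being a morphism of representations. -/
def commutator (S X : QRep.{u, v, w} W) : HomFamily S X →ₗ[ℂ] ArrowFamily S X where
  toFun H b := X.act b.2.2 ∘ₗ H b.1 - H b.2.1 ∘ₗ S.act b.2.2
  map_add' H H' := by
    ext b t
    simp only [LinearMap.sub_apply, LinearMap.comp_apply, Pi.add_apply, LinearMap.add_apply,
      map_add]
    abel
  map_smul' z H := by
    ext b t
    simp only [LinearMap.sub_apply, LinearMap.comp_apply, Pi.smul_apply, LinearMap.smul_apply,
      map_smul, RingHom.id_apply, smul_sub]

variable {S X : QRep.{u, v, w} W}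

lemma commutator_apply (H : HomFamily S X) {x y : W} (b : x ⟶ y) (t : S.sp x) :
    commutator S X H ⟨x, y, b⟩ t = X.act b (H x t) - H y (S.act b t) := rfl

/-- The families which induce homomorphisms from `B` to `X / A`. -/
def relHom (A : ∀ x, Submodule ℂ (X.sp x)) (B : ∀ x, Submodule ℂ (S.sp x)) :
    Submodule ℂ (HomFamily S X) where
  carrier := {H | ∀ b : (Σ x y : W, x ⟶ y), ∀ t ∈ B b.1, commutator S X H b t ∈ A b.2.1}
  add_mem' h h' b t ht := by
    rw [map_add]
    exact (A b.2.1).add_mem (h b t ht) (h' b t ht)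
  zero_mem' b t _ := by
    rw [map_zero]
    exact (A b.2.1).zero_mem
  smul_mem' z H h b t ht := by
    rw [map_smul]
    exact (A b.2.1).smul_mem z (h b t ht)

/-- The families which induce zero from `B` to `X / A`. -/
def nullHom (A : ∀ x, Submodule ℂ (X.sp x)) (B : ∀ x, Submodule ℂ (S.sp x)) :
    Submodule ℂ (HomFamily S X) where
  carrier := {H | ∀ x, ∀ t ∈ B x, H x t ∈ A x}
  add_mem' h h' x t ht := (A x).add_mem (h x t ht) (h' x t ht)
  zero_mem' x _ _ := (A x).zero_mem
  smul_mem' z _ h x t ht := (A x).smul_mem z (h x t ht)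

/-- The normal form of a family with respect to projections onto `A` and `B`. -/
def normalize (P : ∀ x, Module.End ℂ (X.sp x)) (Q : ∀ x, Module.End ℂ (S.sp x)) :
    HomFamily S X →ₗ[ℂ] HomFamily S X where
  toFun H x := (1 - P x) ∘ₗ H x ∘ₗ Q x
  map_add' H H' := by
    ext x t
    simp only [LinearMap.comp_apply, Pi.add_apply, LinearMap.add_apply, map_add]
  map_smul' z H := by
    ext x t
    simp only [LinearMap.comp_apply, Pi.smul_apply, LinearMap.smul_apply, map_smul,
      RingHom.id_apply]

/-- The equations for the families in normal form which induce homomorphisms from `B` to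
`X / A`. -/
def relMap (P : ∀ x, Module.End ℂ (X.sp x)) (Q : ∀ x, Module.End ℂ (S.sp x)) :
    HomFamily S X →ₗ[ℂ] HomFamily S X × ArrowFamily S X where
  toFun H := (H - normalize P Q H, fun b => (1 - P b.2.1) ∘ₗ commutator S X H b ∘ₗ Q b.1)
  map_add' H H' := by
    refine Prod.ext ?_ ?_
    · simp only [map_add, Prod.fst_add]
      abel
    · ext b t
      simp only [LinearMap.comp_apply, map_add, Pi.add_apply, LinearMap.add_apply, Prod.snd_add]
  map_smul' z H := by
    refine Prod.ext ?_ ?_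
    · simp only [map_smul, Prod.smul_fst, RingHom.id_apply, smul_sub]
    · ext b t
      simp only [LinearMap.comp_apply, map_smul, Pi.smul_apply, LinearMap.smul_apply,
        Prod.smul_snd, RingHom.id_apply]

variable {A CA : ∀ x, Submodule ℂ (X.sp x)} {B CB : ∀ x, Submodule ℂ (S.sp x)}

lemma mem_ker_relMap (hA : ∀ x, IsCompl (A x) (CA x)) (hB : ∀ x, IsCompl (B x) (CB x))
    {H : HomFamily S X} :
    H ∈ LinearMap.ker (relMap (fun x => projAlong (A x) (CA x))
      fun x => projAlong (B x) (CB x)) ↔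
    normalize (fun x => projAlong (A x) (CA x)) (fun x => projAlong (B x) (CB x)) H = H ∧
      H ∈ relHom A B := by
  rw [LinearMap.mem_ker]
  change (_, _) = ((0, 0) : HomFamily S X × ArrowFamily S X) ↔ _
  rw [Prod.mk.injEq, sub_eq_zero, eq_comm (a := H)]
  refine and_congr_right fun _ => ?_
  rw [funext_iff]
  exact forall_congr' fun b => sandwich_eq_zero_iff (hA _) (hB _) _

lemma ker_normalize (hA : ∀ x, IsCompl (A x) (CA x)) (hB : ∀ x, IsCompl (B x) (CB x)) :
    LinearMap.ker (normalize (S := S) (X := X) (fun x => projAlong (A x) (CA x))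
      fun x => projAlong (B x) (CB x)) = nullHom A B := by
  ext H
  rw [LinearMap.mem_ker, funext_iff]
  exact forall_congr' fun b => sandwich_eq_zero_iff (hA _) (hB _) _

lemma normalize_normalize (hA : ∀ x, IsCompl (A x) (CA x)) (hB : ∀ x, IsCompl (B x) (CB x))
    (H : HomFamily S X) :
    normalize (fun x => projAlong (A x) (CA x)) (fun x => projAlong (B x) (CB x))
      (normalize (fun x => projAlong (A x) (CA x)) (fun x => projAlong (B x) (CB x)) H) =
    normalize (fun x => projAlong (A x) (CA x)) (fun x => projAlong (B x) (CB x)) H := by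
  ext x t
  change (1 - projAlong (A x) (CA x)) ((1 - projAlong (A x) (CA x)) (H x
    (projAlong (B x) (CB x) (projAlong (B x) (CB x) t)))) =
      (1 - projAlong (A x) (CA x)) (H x (projAlong (B x) (CB x) t))
  rw [projAlong_of_mem (hB x) (projAlong_mem (hB x) t)]
  simp only [LinearMap.sub_apply, Module.End.one_apply, map_sub,
    projAlong_of_mem (hA x) (projAlong_mem (hA x) _), sub_self, sub_zero]

lemma nullHom_le_relHom (hA : ∀ {x y} (b : x ⟶ y), ∀ t ∈ A x, X.act b t ∈ A y)
    (hB : ∀ {x y} (b : x ⟶ y), ∀ t ∈ B x, S.act b t ∈ B y) : nullHom A B ≤ relHom A B :=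
  fun _ h b _ ht => (A b.2.1).sub_mem (hA b.2.2 _ (h _ _ ht)) (h _ _ (hB b.2.2 _ ht))

lemma sub_normalize_mem_nullHom (hA : ∀ x, IsCompl (A x) (CA x))
    (hB : ∀ x, IsCompl (B x) (CB x)) (H : HomFamily S X) :
    H - normalize (fun x => projAlong (A x) (CA x)) (fun x => projAlong (B x) (CB x)) H ∈
      nullHom A B := by
  rw [← ker_normalize hA hB, LinearMap.mem_ker, map_sub, normalize_normalize hA hB, sub_self]

lemma normalize_mem_relHom (hA : ∀ x, IsCompl (A x) (CA x)) (hB : ∀ x, IsCompl (B x) (CB x))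
    (hle : nullHom A B ≤ relHom A B) {H : HomFamily S X} (hH : H ∈ relHom A B) :
    normalize (fun x => projAlong (A x) (CA x)) (fun x => projAlong (B x) (CB x)) H ∈
      relHom A B := by
  have := (relHom A B).sub_mem hH (hle (sub_normalize_mem_nullHom hA hB H))
  rwa [sub_sub_cancel] at this

/-- Normalization is idempotent with kernel `nullHom` and preserves `relHom`, so the normal forms
are a model of the quotient `relHom / nullHom`, that is, of Hom(B, X / A). -/
lemma map_normalize_relHom (hA : ∀ x, IsCompl (A x) (CA x)) (hB : ∀ x, IsCompl (B x) (CB x))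
    (hle : nullHom A B ≤ relHom A B) :
    (relHom A B).map (normalize (fun x => projAlong (A x) (CA x))
      fun x => projAlong (B x) (CB x)) =
    LinearMap.ker (relMap (S := S) (X := X) (fun x => projAlong (A x) (CA x))
      fun x => projAlong (B x) (CB x)) := by
  ext H
  rw [mem_ker_relMap hA hB]
  constructor
  · rintro ⟨H, hH, rfl⟩
    exact ⟨normalize_normalize hA hB H, normalize_mem_relHom hA hB hle hH⟩
  · rintro ⟨h1, h2⟩
    exact ⟨H, h2, h1⟩

lemma finrank_ker_relMap [Finite W] [∀ x, FiniteDimensional ℂ (X.sp x)]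
    [∀ x, FiniteDimensional ℂ (S.sp x)]
    (hA : ∀ x, IsCompl (A x) (CA x)) (hB : ∀ x, IsCompl (B x) (CB x))
    (hle : nullHom A B ≤ relHom A B) :
    Module.finrank ℂ (LinearMap.ker (relMap (S := S) (X := X) (fun x => projAlong (A x) (CA x))
      fun x => projAlong (B x) (CB x))) + Module.finrank ℂ (nullHom A B) =
    Module.finrank ℂ (relHom A B) := by
  have h := LinearMap.finrank_range_add_finrank_ker ((normalize (S := S) (X := X)
    (fun x => projAlong (A x) (CA x)) fun x => projAlong (B x) (CB x)).domRestrict (relHom A B))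
  rw [LinearMap.range_domRestrict, map_normalize_relHom hA hB hle, LinearMap.ker_domRestrict,
    ker_normalize hA hB, (Submodule.comapSubtypeEquivOfLe hle).finrank_eq] at h
  exact h

lemma isRegVec_relMap [Fintype W] [Finite (Σ x y : W, x ⟶ y)]
    [∀ x, FiniteDimensional ℂ (X.sp x)] [∀ x, FiniteDimensional ℂ (S.sp x)] {Z : Type*}
    {R : Subalgebra ℂ (Z → ℂ)} {P : Z → ∀ x, Module.End ℂ (X.sp x)}
    {Q : Z → ∀ x, Module.End ℂ (S.sp x)} (hP : ∀ x, IsRegVec R fun z => P z x)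
    (hQ : ∀ x, IsRegVec R fun z => Q z x) : IsRegVec R fun z => relMap (P z) (Q z) := by
  have := Fintype.ofFinite (Σ x y : W, x ⟶ y)
  refine IsRegVec.of_entries fun φ H => ?_
  refine IsRegVec.prod (IsRegVec.pi fun x => ?_) (IsRegVec.pi fun b => ?_) φ
  · exact (IsRegVec.const _).sub (((IsRegVec.const _).sub (hP x)).comp
      ((IsRegVec.const _).comp (hQ x)))
  · exact (((IsRegVec.const _).sub (hP _)).comp ((IsRegVec.const _).comp (hQ _)))

end QRep
end

noncomputable section

/-! ## Charts of quiver Grassmannians -/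

namespace SubRep

open AlgChart

variable {W : Type u} [Quiver.{v} W] {T X Y S : QRep.{u, v, w} W}

/-- The variety of subrepresentations. -/
def atlas (T : QRep.{u, v, w} W) : AlgAtlas (SubRep T) :=
  AlgAtlas.induced (fun U => U.carrier) (AlgAtlas.pi fun x => grassmannAtlas (T.sp x))

/-- The subrepresentations of given dimension vector. -/
abbrev OfDim (T : QRep.{u, v, w} W) (f : W → ℤ) := {U : SubRep T // U.dimVec = f}

/-- The variety of subrepresentations of given dimension vector. -/
def OfDim.atlas (T : QRep.{u, v, w} W) (f : W → ℤ) : AlgAtlas (OfDim T f) :=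
  AlgAtlas.induced Subtype.val (SubRep.atlas T)

/-- The subrepresentations of `Y` with intersection with `X` of dimension vector `f` and with image
in `S` of dimension vector `g`. -/
abbrev OfDims (ι : X ⟶ Y) (π : Y ⟶ S) (f g : W → ℤ) :=
  {U : SubRep Y // (U.comap ι).dimVec = f ∧ (U.map π).dimVec = g}

/-- The variety structure on `OfDims`. -/
def OfDims.atlas (ι : X ⟶ Y) (π : Y ⟶ S) (f g : W → ℤ) : AlgAtlas (OfDims ι π f g) :=
  AlgAtlas.induced Subtype.val (SubRep.atlas Y)

/-- The map sending a subrepresentation to its intersection with `X` and its image in `S`. -/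
def OfDims.proj (ι : X ⟶ Y) (π : Y ⟶ S) (f g : W → ℤ) (U : OfDims ι π f g) :
    OfDim X f × OfDim S g :=
  (⟨U.1.comap ι, U.2.1⟩, ⟨U.1.map π, U.2.2⟩)

/-- The chart of the quiver Grassmannian belonging to a family of complements. -/
def chart (C : ∀ x, Submodule ℂ (T.sp x)) : AlgChart (SubRep T) :=
  (AlgChart.pi fun x => grassmannChart (C x)).pullback fun U => U.carrier

lemma chart_mem (C : ∀ x, Submodule ℂ (T.sp x)) : chart C ∈ (atlas T).charts :=
  ⟨_, ⟨_, fun x => grassmannChart_mem (C x), rfl⟩, rfl⟩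

lemma isCompatible_atlas [Fintype W] [∀ x, FiniteDimensional ℂ (T.sp x)] :
    (atlas T).IsCompatible :=
  (AlgAtlas.IsCompatible.pi fun _ => isCompatible_grassmannAtlas).induced _

lemma exists_complements (U : SubRep T) : ∃ C : ∀ x, Submodule ℂ (T.sp x),
    ∀ x, IsCompl (U.carrier x) (C x) := by
  choose C hC using fun x => (U.carrier x).exists_isCompl
  exact ⟨C, hC⟩

lemma isRegVec_projAlong_chart [∀ x, FiniteDimensional ℂ (T.sp x)]
    (C : ∀ x, Submodule ℂ (T.sp x)) (U : SubRep T) (x : W) :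
    IsRegVec ((chart C).localRing U) fun U => projAlong (U.carrier x) (C x) :=
  .of_entries fun φ t => ring_le_localRing _ _ (coord_mem_ring ⟨_, ⟨x, _, ⟨φ, t, rfl⟩, rfl⟩, rfl⟩)

end SubRep

lemma IsRegVec.comp_chartMap {X Y : Type*} {E : Type*} [AddCommGroup E] [Module ℂ E]
    {c : AlgChart X} {c' : AlgChart Y} {F : X → Y} {x : X} (H : AlgChart.ChartMap c c' F x)
    {v : Y → E} (hv : IsRegVec (c'.localRing (F x)) v) :
    IsRegVec (c.localRing x) fun y => v (F y) :=
  fun φ => H.localRing_mem (hv φ)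

namespace SubRep

open AlgChart QRep

variable {W : Type u} [Quiver.{v} W] {X Y S : QRep.{u, v, w} W} {f g : W → ℤ}

/-- The chart of the base belonging to two families of complements. -/
def baseChart (f g : W → ℤ) (C : ∀ x, Submodule ℂ (X.sp x)) (D : ∀ x, Submodule ℂ (S.sp x)) :
    AlgChart (OfDim X f × OfDim S g) :=
  ((chart C).pullback Subtype.val).prod ((chart D).pullback Subtype.val)

lemma baseChart_mem (C : ∀ x, Submodule ℂ (X.sp x)) (D : ∀ x, Submodule ℂ (S.sp x)) :
    baseChart f g C D ∈ ((OfDim.atlas X f).prod (OfDim.atlas S g)).charts :=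
  ⟨_, ⟨_, chart_mem C, rfl⟩, _, ⟨_, chart_mem D, rfl⟩, rfl⟩

section Base

variable {C : ∀ x, Submodule ℂ (X.sp x)} {D : ∀ x, Submodule ℂ (S.sp x)}

lemma isRegVec_fst [∀ x, FiniteDimensional ℂ (X.sp x)] {q : OfDim X f × OfDim S g}
    (hq : q ∈ (baseChart f g C D).dom) (x : W) :
    IsRegVec ((baseChart f g C D).localRing q) fun q => projAlong (q.1.1.carrier x) (C x) :=
  IsRegVec.comp_chartMap (F := Subtype.val ∘ Prod.fst)
    ((chartMap_pullback_self (chart C) Subtype.val hq.1).comp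
    (chartMap_fst _ ((chart D).pullback Subtype.val) hq)) (isRegVec_projAlong_chart C q.1.1 x)

lemma isRegVec_snd [∀ x, FiniteDimensional ℂ (S.sp x)] {q : OfDim X f × OfDim S g}
    (hq : q ∈ (baseChart f g C D).dom) (x : W) :
    IsRegVec ((baseChart f g C D).localRing q) fun q => projAlong (q.2.1.carrier x) (D x) :=
  IsRegVec.comp_chartMap (F := Subtype.val ∘ Prod.snd)
    ((chartMap_pullback_self (chart D) Subtype.val hq.2).comp
    (chartMap_snd ((chart C).pullback Subtype.val) _ hq)) (isRegVec_projAlong_chart D q.2.1 x)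

variable (C D) in
/-- The equations, depending on a point of the base, for homomorphisms in normal form. -/
def eqs (q : OfDim X f × OfDim S g) : HomFamily S X →ₗ[ℂ] HomFamily S X × ArrowFamily S X :=
  relMap (fun x => projAlong (q.1.1.carrier x) (C x)) fun x => projAlong (q.2.1.carrier x) (D x)

lemma isRegVec_eqs [Fintype W] [Finite (Σ x y : W, x ⟶ y)] [∀ x, FiniteDimensional ℂ (X.sp x)]
    [∀ x, FiniteDimensional ℂ (S.sp x)] {q : OfDim X f × OfDim S g}
    (hq : q ∈ (baseChart f g C D).dom) :
    IsRegVec ((baseChart f g C D).localRing q) (eqs C D) :=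
  isRegVec_relMap (isRegVec_fst hq) (isRegVec_snd hq)

variable (f g) in
/-- All spaces of homomorphisms from a subrepresentation of `S` of dimension vector `g` to a
quotient of `X` by a subrepresentation of dimension vector `f` have dimension `n`. -/
def HasHomDim (X S : QRep.{u, v, w} W) (n : ℕ) : Prop :=
  ∀ q : OfDim X f × OfDim S g, Module.finrank ℂ (relHom q.1.1.carrier q.2.1.carrier) =
    n + Module.finrank ℂ (nullHom q.1.1.carrier q.2.1.carrier)

/-- Constancy of this dimension over the chart is what allows the kernels to be trivialized
together. -/
lemma finrank_ker_eqs [Finite W] [∀ x, FiniteDimensional ℂ (X.sp x)]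
    [∀ x, FiniteDimensional ℂ (S.sp x)] {n : ℕ} (hn : HasHomDim f g X S n)
    {q : OfDim X f × OfDim S g} (hq : q ∈ (baseChart f g C D).dom) :
    Module.finrank ℂ (LinearMap.ker (eqs C D q)) = n := by
  have h := finrank_ker_relMap hq.1 hq.2
    (nullHom_le_relHom (fun b => q.1.1.stable b) (fun b => q.2.1.stable b))
  rw [hn q, Nat.add_right_cancel_iff] at h
  exact h

end Base

/-- The data defining a trivialization near a point of the base. -/
structure TrivData (X S : QRep.{u, v, w} W) (f g : W → ℤ) (n : ℕ) where
  C : ∀ x, Submodule ℂ (X.sp x)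
  D : ∀ x, Submodule ℂ (S.sp x)
  pt : OfDim X f × OfDim S g
  pt_mem : pt ∈ (baseChart f g C D).dom
  inv : HomFamily S X × ArrowFamily S X →ₗ[ℂ] HomFamily S X
  inv_spec : eqs C D pt ∘ₗ inv ∘ₗ eqs C D pt = eqs C D pt
  coords : LinearMap.ker (eqs C D pt) ≃ₗ[ℂ] (Fin n → ℂ)

namespace TrivData

lemma exists_pt_eq [Finite W] [∀ x, FiniteDimensional ℂ (X.sp x)]
    [∀ x, FiniteDimensional ℂ (S.sp x)] {n : ℕ} (hn : HasHomDim f g X S n)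
    (q : OfDim X f × OfDim S g) : ∃ τ : TrivData X S f g n, τ.pt = q := by
  obtain ⟨C, hC⟩ := q.1.1.exists_complements
  obtain ⟨D, hD⟩ := q.2.1.exists_complements
  have hq : q ∈ (baseChart f g C D).dom := ⟨hC, hD⟩
  obtain ⟨R, hR⟩ := exists_generalized_inverse (eqs C D q)
  exact ⟨⟨C, D, q, hq, R, hR, LinearEquiv.ofFinrankEq _ _ (by
    rw [finrank_ker_eqs hn hq, Module.finrank_fin_fun])⟩, rfl⟩

variable {n : ℕ} (τ : TrivData X S f g n)

/-- The deformation identifying the solutions of the equations at two points of the base. -/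
def deform (q : OfDim X f × OfDim S g) : Module.End ℂ (HomFamily S X) :=
  1 + τ.inv ∘ₗ (eqs τ.C τ.D q - eqs τ.C τ.D τ.pt)

/-- The open set over which there is a trivialization. -/
def base : Set (OfDim X f × OfDim S g) :=
  {q ∈ (baseChart f g τ.C τ.D).dom | LinearMap.det (τ.deform q) ≠ 0}

/-- The projection onto the solutions of the equations at the base point. -/
def toKer : HomFamily S X →ₗ[ℂ] LinearMap.ker (eqs τ.C τ.D τ.pt) :=
  (1 - τ.inv ∘ₗ eqs τ.C τ.D τ.pt).codRestrict _ fun H => by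
    have := LinearMap.congr_fun τ.inv_spec H
    simp only [LinearMap.comp_apply] at this
    simp [LinearMap.mem_ker, this]

lemma pt_mem_base : τ.pt ∈ τ.base := by
  refine ⟨τ.pt_mem, ?_⟩
  rw [deform, sub_self, LinearMap.comp_zero, add_zero, map_one]
  exact one_ne_zero

lemma isUnit_deform [Finite W] [∀ x, FiniteDimensional ℂ (X.sp x)]
    [∀ x, FiniteDimensional ℂ (S.sp x)] {q : OfDim X f × OfDim S g} (hq : q ∈ τ.base) :
    IsUnit (τ.deform q) := by
  rw [LinearMap.isUnit_iff_isUnit_det, isUnit_iff_ne_zero]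
  exact hq.2

/-- On solutions at `q` the term `inv ∘ eqs q` vanishes. So the fibre coordinate of a solution is a
fixed linear function of it, and `q` enters only through the inverse map. -/
lemma toKer_of_mem_ker {q : OfDim X f × OfDim S g} {H : HomFamily S X}
    (hH : eqs τ.C τ.D q H = 0) : (τ.toKer H : HomFamily S X) = τ.deform q H := by
  simp [toKer, deform, hH, sub_eq_add_neg]

/-- The solution of the equations at a point of the base with given coordinates. -/
def solution (q : OfDim X f × OfDim S g) : (Fin n → ℂ) →ₗ[ℂ] HomFamily S X :=
  Ring.inverse (τ.deform q) ∘ₗ (LinearMap.ker (eqs τ.C τ.D τ.pt)).subtype ∘ₗ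
    τ.coords.symm.toLinearMap

section

variable [Finite W] [∀ x, FiniteDimensional ℂ (X.sp x)] [∀ x, FiniteDimensional ℂ (S.sp x)]

lemma solution_coords {q : OfDim X f × OfDim S g} (hq : q ∈ τ.base) {H : HomFamily S X}
    (hH : eqs τ.C τ.D q H = 0) : τ.solution q (τ.coords (τ.toKer H)) = H := by
  simp only [solution, LinearMap.comp_apply, LinearEquiv.coe_coe, LinearEquiv.symm_apply_apply,
    Submodule.subtype_apply, τ.toKer_of_mem_ker hH]
  exact LinearMap.congr_fun (Ring.inverse_mul_cancel _ (τ.isUnit_deform hq)) H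

lemma eqs_solution (hn : HasHomDim f g X S n) {q : OfDim X f × OfDim S g} (hq : q ∈ τ.base)
    (z : Fin n → ℂ) : eqs τ.C τ.D q (τ.solution q z) = 0 :=
  inverse_mem_ker τ.inv_spec (by rw [finrank_ker_eqs hn hq.1, finrank_ker_eqs hn τ.pt_mem])
    (τ.isUnit_deform hq) (τ.coords.symm z).2

lemma coords_solution (hn : HasHomDim f g X S n) {q : OfDim X f × OfDim S g} (hq : q ∈ τ.base)
    (z : Fin n → ℂ) : τ.coords (τ.toKer (τ.solution q z)) = z := by
  rw [← LinearEquiv.eq_symm_apply]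
  apply Subtype.ext
  rw [τ.toKer_of_mem_ker (τ.eqs_solution hn hq z)]
  exact LinearMap.congr_fun (Ring.mul_inverse_cancel _ (τ.isUnit_deform hq)) _

end

section

variable [Fintype W] [Finite (Σ x y : W, x ⟶ y)] [∀ x, FiniteDimensional ℂ (X.sp x)]
  [∀ x, FiniteDimensional ℂ (S.sp x)]

lemma isRegVec_deform {q : OfDim X f × OfDim S g} (hq : q ∈ (baseChart f g τ.C τ.D).dom) :
    IsRegVec ((baseChart f g τ.C τ.D).localRing q) τ.deform :=
  (IsRegVec.const _).add ((IsRegVec.const _).comp ((isRegVec_eqs hq).sub (.const _)))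

lemma isOpen_base : IsOpen[((OfDim.atlas X f).prod (OfDim.atlas S g)).zariski] τ.base := by
  refine AlgAtlas.isOpen_of_forall_basicOpen _ fun q hq => ?_
  obtain ⟨h, hh, h0, hs⟩ := exists_basicOpen_ne_zero hq.1 (τ.isRegVec_deform hq.1).det hq.2
  exact ⟨_, baseChart_mem τ.C τ.D, hq.1, h, hh, h0, fun y hy => ⟨hy.1, hs y hy⟩⟩

lemma isRegVec_inverse_deform {q : OfDim X f × OfDim S g} (hq : q ∈ τ.base) :
    IsRegVec ((baseChart f g τ.C τ.D).localRing q) fun q => Ring.inverse (τ.deform q) :=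
  (τ.isRegVec_deform hq.1).inverse (inv_mem_localRing hq.1 (τ.isRegVec_deform hq.1).det hq.2)

end

end TrivData

end SubRep
end

noncomputable section

/-! ## The affine bundle -/

namespace SubRep

open AlgChart QRep

variable {W : Type u} [Quiver.{v} W] {X Y S : QRep.{u, v, w} W} {f g : W → ℤ}
  {ι : X ⟶ Y} {ρ : Y ⟶ X} {π : Y ⟶ S} {σ : S ⟶ Y}

/-- The subrepresentation of `Y` with intersection `A` with `X` and image `B` in `S` which belongs
to a homomorphism from `B` to `X / A`. -/
def graph (ρ : Y ⟶ X) (π : Y ⟶ S) (A : SubRep X) (B : SubRep S) (H : HomFamily S X)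
    (hH : H ∈ relHom A.carrier B.carrier) : SubRep Y where
  carrier x := graphSubmodule (homAt ρ x) (homAt π x) (A.carrier x) (B.carrier x) (H x)
  stable {x y} b t ht := by
    rw [mem_graphSubmodule] at ht ⊢
    rw [homAt_act, homAt_act]
    refine ⟨B.stable b _ ht.1, ?_⟩
    have h1 := hH ⟨x, y, b⟩ _ ht.1
    rw [commutator_apply] at h1
    have h2 := (A.carrier y).add_mem (A.stable b _ ht.2) h1
    rwa [map_sub, sub_add_sub_cancel] at h2

/-- The entry `S → X` of the projections to a subrepresentation of `Y`. -/
def entry (ρ : Y ⟶ X) (π : Y ⟶ S) (σ : S ⟶ Y) (C : ∀ x, Submodule ℂ (X.sp x))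
    (D : ∀ x, Submodule ℂ (S.sp x)) (U : SubRep Y) : HomFamily S X := fun x =>
  homAt ρ x ∘ₗ projAlong (U.carrier x)
    (graphSubmodule (homAt ρ x) (homAt π x) (C x) (D x) 0) ∘ₗ homAt σ x

variable {C : ∀ x, Submodule ℂ (X.sp x)} {D : ∀ x, Submodule ℂ (S.sp x)}

section

variable (h : ∀ x, IsDirectSum (homAt ι x) (homAt ρ x) (homAt π x) (homAt σ x))
include h

lemma comap_graph {A : SubRep X} {B : SubRep S} {H : HomFamily S X}
    (hH : H ∈ relHom A.carrier B.carrier) : (graph ρ π A B H hH).comap ι = A :=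
  SubRep.ext (funext fun x => (h x).comap_graphSubmodule)

lemma map_graph {A : SubRep X} {B : SubRep S} {H : HomFamily S X}
    (hH : H ∈ relHom A.carrier B.carrier) : (graph ρ π A B H hH).map π = B :=
  SubRep.ext (funext fun x => (h x).map_graphSubmodule)

lemma carrier_eq_graphSubmodule {U : SubRep Y}
    (hC : ∀ x, IsCompl ((U.comap ι).carrier x) (C x))
    (hD : ∀ x, IsCompl ((U.map π).carrier x) (D x)) (x : W) :
    U.carrier x = graphSubmodule (homAt ρ x) (homAt π x) ((U.comap ι).carrier x)
      ((U.map π).carrier x) (entry ρ π σ C D U x) :=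
  (h x).eq_graphSubmodule rfl rfl (hC x) (hD x)

/-- `H` may be any representative, in particular the entry for other complements; this is the source
of the linear transition maps. -/
lemma entry_of_carrier_eq {U : SubRep Y} {A : SubRep X} {B : SubRep S} {H : HomFamily S X}
    (hU : ∀ x, U.carrier x = graphSubmodule (homAt ρ x) (homAt π x) (A.carrier x)
      (B.carrier x) (H x))
    (hC : ∀ x, IsCompl (A.carrier x) (C x)) (hD : ∀ x, IsCompl (B.carrier x) (D x)) :
    entry ρ π σ C D U = normalize (fun x => projAlong (A.carrier x) (C x))
      (fun x => projAlong (B.carrier x) (D x)) H := by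
  ext1 x
  rw [entry, hU x]
  exact (h x).entry_graphSubmodule (hC x) (hD x)

/-- Stability of U applied to σ t + ι (H t), for t ∈ B, is exactly the condition on the commutator.
-/
lemma mem_relHom_of_carrier_eq {U : SubRep Y} {A : SubRep X} {B : SubRep S} {H : HomFamily S X}
    (hU : ∀ x, U.carrier x = graphSubmodule (homAt ρ x) (homAt π x) (A.carrier x)
      (B.carrier x) (H x)) : H ∈ relHom A.carrier B.carrier := by
  rintro ⟨x, y, b⟩ t ht
  have h1 := U.stable b _ ((hU x).symm ▸ (h x).add_mem_graphSubmodule (H := H x) ht)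
  rw [hU y, mem_graphSubmodule, homAt_act, homAt_act, map_add (homAt π x), map_add (homAt ρ x), (h x).ρ_σ, (h x).π_ι,
    (h x).proj_inl, (h x).proj_inr, zero_add, add_zero] at h1
  exact h1.2

lemma entry_mem_ker {U : OfDims ι π f g}
    (hU : OfDims.proj ι π f g U ∈ (baseChart f g C D).dom) :
    eqs C D (OfDims.proj ι π f g U) (entry ρ π σ C D U.1) = 0 := by
  have hg := carrier_eq_graphSubmodule h hU.1 hU.2
  exact (mem_ker_relMap hU.1 hU.2).2
    ⟨(entry_of_carrier_eq h hg hU.1 hU.2).symm, mem_relHom_of_carrier_eq h hg⟩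

lemma isCompl_carrier {U : OfDims ι π f g}
    (hU : OfDims.proj ι π f g U ∈ (baseChart f g C D).dom) (x : W) :
    IsCompl (U.1.carrier x) (graphSubmodule (homAt ρ x) (homAt π x) (C x) (D x) 0) :=
  (h x).isCompl_of_comap_of_map rfl rfl (hU.1 x) (hU.2 x)

lemma proj_mem_dom [∀ x, FiniteDimensional ℂ (X.sp x)] [∀ x, FiniteDimensional ℂ (S.sp x)]
    {q : OfDim X f × OfDim S g} (hq : q ∈ (baseChart f g C D).dom) {U : OfDims ι π f g}
    (hU : ∀ x, IsCompl (U.1.carrier x)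
      (graphSubmodule (homAt ρ x) (homAt π x) (C x) (D x) 0)) :
    OfDims.proj ι π f g U ∈ (baseChart f g C D).dom := by
  refine ⟨fun x => ?_, fun x => ?_⟩
  · refine isCompl_of_disjoint_of_finrank_eq ((h x).disjoint_comap (hU x)) (hq.1 x) ?_
    have := congrFun (U.2.1.trans q.1.2.symm) x
    exact Nat.cast_injective (R := ℤ) this
  · refine isCompl_of_codisjoint_of_finrank_eq ((h x).codisjoint_map (hU x)) (hq.2 x) ?_
    have := congrFun (U.2.2.trans q.2.2.symm) x
    exact Nat.cast_injective (R := ℤ) this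

/-- The chart of the total space adapted to two families of complements. -/
abbrev totalChart (ι : X ⟶ Y) (ρ : Y ⟶ X) (π : Y ⟶ S) (f g : W → ℤ)
    (C : ∀ x, Submodule ℂ (X.sp x)) (D : ∀ x, Submodule ℂ (S.sp x)) :
    AlgChart (OfDims ι π f g) :=
  (chart fun x => graphSubmodule (homAt ρ x) (homAt π x) (C x) (D x) 0).pullback Subtype.val

omit h in
lemma totalChart_mem : totalChart ι ρ π f g C D ∈ (OfDims.atlas ι π f g).charts :=
  ⟨_, chart_mem _, rfl⟩

section

variable [∀ x, FiniteDimensional ℂ (Y.sp x)]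

omit h in
lemma isRegVec_projAlong_totalChart {U : OfDims ι π f g}
    (hU : U ∈ (totalChart ι ρ π f g C D).dom) (x : W) :
    IsRegVec ((totalChart ι ρ π f g C D).localRing U) fun U => projAlong (U.1.carrier x)
      (graphSubmodule (homAt ρ x) (homAt π x) (C x) (D x) 0) :=
  IsRegVec.comp_chartMap (chartMap_pullback_self _ Subtype.val hU)
    (isRegVec_projAlong_chart _ U.1 x)

variable [∀ x, FiniteDimensional ℂ (X.sp x)] [∀ x, FiniteDimensional ℂ (S.sp x)]

lemma chartMap_proj [Fintype W] {U : OfDims ι π f g}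
    (hU : OfDims.proj ι π f g U ∈ (baseChart f g C D).dom) :
    ChartMap (totalChart ι ρ π f g C D) (baseChart f g C D) (OfDims.proj ι π f g) U := by
  have hU' : U ∈ (totalChart ι ρ π f g C D).dom := isCompl_carrier h hU
  have hdom (V) (hV : V ∈ (totalChart ι ρ π f g C D).dom) := proj_mem_dom h hU hV
  refine chartMap_prod (chartMap_pullback (chartMap_pullback (chartMap_pi hU' fun x => ?_)))
    (chartMap_pullback (chartMap_pullback (chartMap_pi hU' fun x => ?_)))
  · refine .of_forall_mem hU' (fun V hV => (hdom V hV).1 x) ?_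
    rintro _ ⟨φ, t, rfl⟩
    refine localRing_congr_dom (((isRegVec_projAlong_totalChart hU' x).apply
      (.const (homAt ι x t))).map (homAt ρ x) φ) fun V hV => congrArg φ ?_
    exact ((h x).projAlong_ι rfl ((hdom V hV).1 x) (hV x) t).symm
  · refine .of_forall_mem hU' (fun V hV => (hdom V hV).2 x) ?_
    rintro _ ⟨φ, t, rfl⟩
    refine localRing_congr_dom (((isRegVec_projAlong_totalChart hU' x).apply
      (.const (homAt σ x t))).map (homAt π x) φ) fun V hV => congrArg φ ?_
    exact ((h x).projAlong_σ rfl ((hdom V hV).2 x) (hV x) t).symm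

lemma isMorphism_proj [Fintype W] : (OfDims.atlas ι π f g).IsMorphism
    ((OfDim.atlas X f).prod (OfDim.atlas S g)) (OfDims.proj ι π f g) := by
  refine AlgAtlas.isMorphism_of_chartMap
    ((isCompatible_atlas.induced _).prod (isCompatible_atlas.induced _)) fun U => ?_
  obtain ⟨C, hC⟩ := exists_complements (U.1.comap ι)
  obtain ⟨D, hD⟩ := exists_complements (U.1.map π)
  exact ⟨_, totalChart_mem, _, baseChart_mem C D, chartMap_proj h ⟨hC, hD⟩⟩

omit h in
lemma isRegVec_entry [Fintype W] {U : OfDims ι π f g}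
    (hU : U ∈ (totalChart ι ρ π f g C D).dom) :
    IsRegVec ((totalChart ι ρ π f g C D).localRing U) fun U => entry ρ π σ C D U.1 :=
  .pi fun x => (IsRegVec.const _).comp ((isRegVec_projAlong_totalChart hU x).comp (.const _))

end

end

/-! ### Trivializations and their transition maps. -/

namespace TrivData

variable {n : ℕ} [Fintype W] [∀ x, FiniteDimensional ℂ (X.sp x)]
  [∀ x, FiniteDimensional ℂ (S.sp x)]

lemma solution_mem_relHom (hn : HasHomDim f g X S n) (τ : TrivData X S f g n)
    {q : OfDim X f × OfDim S g} (hq : q ∈ τ.base) (z : Fin n → ℂ) :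
    τ.solution q z ∈ relHom q.1.1.carrier q.2.1.carrier :=
  ((mem_ker_relMap hq.1.1 hq.1.2).1 (τ.eqs_solution hn hq z)).2

lemma normalize_solution (hn : HasHomDim f g X S n) (τ : TrivData X S f g n)
    {q : OfDim X f × OfDim S g} (hq : q ∈ τ.base) (z : Fin n → ℂ) :
    normalize (fun x => projAlong (q.1.1.carrier x) (τ.C x))
      (fun x => projAlong (q.2.1.carrier x) (τ.D x)) (τ.solution q z) = τ.solution q z :=
  ((mem_ker_relMap hq.1.1 hq.1.2).1 (τ.eqs_solution hn hq z)).1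

variable (h : ∀ x, IsDirectSum (homAt ι x) (homAt ρ x) (homAt π x) (homAt σ x))
  (hn : HasHomDim f g X S n) (τ : TrivData X S f g n)

/-- The fibre coordinates. -/
def fibreCoord (ρ : Y ⟶ X) (π : Y ⟶ S) (σ : S ⟶ Y) (τ : TrivData X S f g n) (U : SubRep Y) :
    Fin n → ℂ :=
  τ.coords (τ.toKer (entry ρ π σ τ.C τ.D U))

/-- The subrepresentation with given fibre coordinates. -/
def ofCoord (q : OfDim X f × OfDim S g) (hq : q ∈ τ.base) (z : Fin n → ℂ) : OfDims ι π f g :=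
  ⟨graph ρ π q.1.1 q.2.1 (τ.solution q z) (τ.solution_mem_relHom hn hq z), by
    rw [comap_graph h, map_graph h]
    exact ⟨q.1.2, q.2.2⟩⟩

lemma proj_ofCoord (q : OfDim X f × OfDim S g) (hq : q ∈ τ.base) (z : Fin n → ℂ) :
    OfDims.proj ι π f g (τ.ofCoord h hn q hq z) = q :=
  Prod.ext (Subtype.ext (comap_graph h (τ.solution_mem_relHom hn hq z)))
    (Subtype.ext (map_graph h (τ.solution_mem_relHom hn hq z)))

lemma fibreCoord_ofCoord (q : OfDim X f × OfDim S g) (hq : q ∈ τ.base) (z : Fin n → ℂ) :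
    fibreCoord ρ π σ τ (τ.ofCoord h hn q hq z).1 = z := by
  have h1 : entry ρ π σ τ.C τ.D (τ.ofCoord h hn q hq z).1 = τ.solution q z :=
    (entry_of_carrier_eq h (fun _ => rfl) hq.1.1 hq.1.2).trans (τ.normalize_solution hn hq z)
  rw [fibreCoord, h1, τ.coords_solution hn hq]

include h in
lemma solution_fibreCoord {U : OfDims ι π f g} (hU : OfDims.proj ι π f g U ∈ τ.base) :
    τ.solution (OfDims.proj ι π f g U) (fibreCoord ρ π σ τ U.1) = entry ρ π σ τ.C τ.D U.1 :=
  τ.solution_coords hU (entry_mem_ker h hU.1)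

lemma ofCoord_fibreCoord {U : OfDims ι π f g} (hU : OfDims.proj ι π f g U ∈ τ.base) :
    τ.ofCoord h hn _ hU (fibreCoord ρ π σ τ U.1) = U := by
  refine Subtype.ext (SubRep.ext (funext fun x => ?_))
  refine Eq.trans ?_ (carrier_eq_graphSubmodule h hU.1.1 hU.1.2 x).symm
  change graphSubmodule _ _ _ _ (τ.solution _ _ x) = _
  rw [τ.solution_fibreCoord h hU]
  rfl

/-- The trivialization as a bijection. -/
def equiv : (OfDims.proj ι π f g ⁻¹' τ.base) ≃ τ.base × (Fin n → ℂ) where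
  toFun U := (⟨OfDims.proj ι π f g U.1, U.2⟩, fibreCoord ρ π σ τ U.1.1)
  invFun p := ⟨τ.ofCoord h hn p.1.1 p.1.2 p.2, by
    rw [Set.mem_preimage, proj_ofCoord]
    exact p.1.2⟩
  left_inv U := Subtype.ext (τ.ofCoord_fibreCoord h hn U.2)
  right_inv p := Prod.ext (Subtype.ext (τ.proj_ofCoord h hn _ p.1.2 _))
    (τ.fibreCoord_ofCoord h hn _ p.1.2 _)

variable [Finite (Σ x y : W, x ⟶ y)] [∀ x, FiniteDimensional ℂ (Y.sp x)]

omit [Finite (Σ x y : W, x ⟶ y)] in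
lemma isMorphism_equiv : (AlgAtlas.induced Subtype.val (OfDims.atlas ι π f g)).IsMorphism
    ((AlgAtlas.induced Subtype.val ((OfDim.atlas X f).prod (OfDim.atlas S g))).prod
      (AlgAtlas.affineSpace n)) (τ.equiv h hn) := by
  refine AlgAtlas.isMorphism_of_chartMap ((((isCompatible_atlas.induced _).prod
    (isCompatible_atlas.induced _)).induced _).prod (AlgAtlas.isCompatible_affineSpace n))
    fun U => ?_
  have hU : U.1 ∈ (totalChart ι ρ π f g τ.C τ.D).dom := isCompl_carrier h U.2.1
  have hval := chartMap_pullback_self (totalChart ι ρ π f g τ.C τ.D)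
    (Subtype.val : (OfDims.proj ι π f g ⁻¹' τ.base) → _) hU
  refine ⟨_, ⟨_, totalChart_mem, rfl⟩, _, ⟨_, ⟨_, baseChart_mem τ.C τ.D, rfl⟩, _, rfl, rfl⟩,
    chartMap_prod (chartMap_pullback ((chartMap_proj h U.2.1).comp hval)) ?_⟩
  refine .of_forall_mem hU (fun _ _ => Set.mem_univ _) ?_
  rintro _ ⟨i, rfl⟩
  exact IsRegVec.comp_chartMap hval (((isRegVec_entry hU).map τ.toKer).map
    τ.coords.toLinearMap) (LinearMap.proj i)

/-- The projection onto a graph is polynomial in the projections to A and B and in the solution; the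
latter involves the inverse of `deform`, whose determinant is invertible over the base. -/
lemma isMorphism_equiv_symm :
    ((AlgAtlas.induced Subtype.val ((OfDim.atlas X f).prod (OfDim.atlas S g))).prod
      (AlgAtlas.affineSpace n)).IsMorphism
    (AlgAtlas.induced Subtype.val (OfDims.atlas ι π f g)) (τ.equiv h hn).symm := by
  refine AlgAtlas.isMorphism_of_chartMap ((isCompatible_atlas.induced _).induced _) fun p => ?_
  let aff : AlgChart (Fin n → ℂ) := ⟨Set.univ, {a | ∃ i, a = fun x => x i}⟩
  let c := ((baseChart f g τ.C τ.D).pullback (Subtype.val : τ.base → _)).prod aff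
  have hc {p : τ.base × (Fin n → ℂ)} : p ∈ c.dom := ⟨p.1.2.1, Set.mem_univ _⟩
  have hval : ChartMap c (baseChart f g τ.C τ.D) (Subtype.val ∘ Prod.fst) p :=
    (chartMap_pullback_self (baseChart f g τ.C τ.D) Subtype.val p.1.2.1).comp
      (chartMap_fst _ aff hc)
  have hz : IsRegVec (c.localRing p) fun p => p.2 := by
    refine .pi fun i => IsRegVec.of_mem ?_
    exact ring_le_localRing _ _ (coord_mem_ring (.inr ⟨_, ⟨i, rfl⟩, rfl⟩))
  have hP (x) := IsRegVec.comp_chartMap hval (isRegVec_fst p.1.2.1 x)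
  have hQ (x) := IsRegVec.comp_chartMap hval (isRegVec_snd p.1.2.1 x)
  have hH : IsRegVec (c.localRing p) fun p => τ.solution p.1.1 p.2 :=
    (IsRegVec.comp_chartMap hval (τ.isRegVec_inverse_deform p.1.2)).apply
      (hz.map ((LinearMap.ker (eqs τ.C τ.D τ.pt)).subtype ∘ₗ τ.coords.symm.toLinearMap))
  refine ⟨c, ⟨_, ⟨_, baseChart_mem τ.C τ.D, rfl⟩, _, rfl, rfl⟩, _,
    ⟨_, totalChart_mem (ρ := ρ) (C := τ.C) (D := τ.D), rfl⟩,
    chartMap_pullback (chartMap_pullback (chartMap_pullback (chartMap_pi hc fun x => ?_)))⟩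
  have hcompl (p : τ.base × (Fin n → ℂ)) :=
    (h x).isCompl_graphSubmodule (H := τ.solution p.1.1 p.2 x) (p.1.2.1.1 x) (p.1.2.1.2 x)
  refine .of_forall_mem hc (fun p _ => (hcompl p).1) ?_
  rintro _ ⟨φ, t, rfl⟩
  have hQt := (hQ x).apply (.const (homAt π x t))
  have hHQ := (hH.map (LinearMap.proj x)).apply hQt
  refine localRing_congr_dom ((hQt.map (homAt σ x)).add ((hHQ.add ((hP x).apply
    ((IsRegVec.const (homAt ρ x t)).sub hHQ))).map (homAt ι x)) φ) fun p _ => congrArg φ ?_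
  exact (hcompl p).2 t

/-- The trivialization. -/
def localTriv : LocalTriv (OfDims.atlas ι π f g)
    ((OfDim.atlas X f).prod (OfDim.atlas S g)) (OfDims.proj ι π f g) n where
  base := τ.base
  isOpen_base := τ.isOpen_base
  equiv := τ.equiv h hn
  fst_equiv _ := rfl
  morphism := τ.isMorphism_equiv h hn
  morphism_symm := τ.isMorphism_equiv_symm h hn

/-- The transition maps on the fibres. -/
def transition (τ τ' : TrivData X S f g n) (q : OfDim X f × OfDim S g) :
    (Fin n → ℂ) →ₗ[ℂ] (Fin n → ℂ) :=
  τ'.coords.toLinearMap ∘ₗ τ'.toKer ∘ₗ normalize (fun x => projAlong (q.1.1.carrier x) (τ'.C x))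
    (fun x => projAlong (q.2.1.carrier x) (τ'.D x)) ∘ₗ τ.solution q

omit [Finite (Σ x y : W, x ⟶ y)] [∀ x, FiniteDimensional ℂ (Y.sp x)] in
include h in
lemma transition_fibreCoord (τ τ' : TrivData X S f g n) {U : OfDims ι π f g}
    (hU : OfDims.proj ι π f g U ∈ τ.base) (hU' : OfDims.proj ι π f g U ∈ τ'.base) :
    transition τ τ' (OfDims.proj ι π f g U) (fibreCoord ρ π σ τ U.1) =
      fibreCoord ρ π σ τ' U.1 := by
  simp only [transition, LinearMap.comp_apply, τ.solution_fibreCoord h hU, LinearEquiv.coe_coe]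
  rw [fibreCoord, entry_of_carrier_eq h (carrier_eq_graphSubmodule h hU.1.1 hU.1.2) hU'.1.1
    hU'.1.2]
  rfl

-- Every fibre vector is the coordinate of an actual subrepresentation, on which both transitions
-- just compare coordinates.
omit [Finite (Σ x y : W, x ⟶ y)] [∀ x, FiniteDimensional ℂ (Y.sp x)] in
include h hn in
lemma transition_transition (τ τ' : TrivData X S f g n) {q : OfDim X f × OfDim S g}
    (hq : q ∈ τ.base) (hq' : q ∈ τ'.base) (z : Fin n → ℂ) :
    transition τ' τ q (transition τ τ' q z) = z := by
  have h1 := τ.proj_ofCoord h hn q hq z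
  have h2 := τ.fibreCoord_ofCoord h hn q hq z
  generalize τ.ofCoord h hn q hq z = U at h1 h2
  subst h1
  rw [← h2, transition_fibreCoord h τ τ' hq hq', transition_fibreCoord h τ' τ hq' hq]

include h hn in
/-- The transition maps on the fibres are bijective. -/
def transitionEquiv (τ τ' : TrivData X S f g n) {q : OfDim X f × OfDim S g}
    (hq : q ∈ τ.base) (hq' : q ∈ τ'.base) : (Fin n → ℂ) ≃ₗ[ℂ] (Fin n → ℂ) where
  __ := transition τ τ' q
  invFun := transition τ' τ q
  left_inv := transition_transition h hn τ τ' hq hq'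
  right_inv := transition_transition h hn τ' τ hq' hq

end TrivData

/-- Subrepresentations of a direct sum form an affine bundle over pairs of subrepresentations of the
summands. -/
theorem isAffineBundle_proj [Fintype W] [Finite (Σ x y : W, x ⟶ y)]
    [∀ x, FiniteDimensional ℂ (X.sp x)] [∀ x, FiniteDimensional ℂ (Y.sp x)]
    [∀ x, FiniteDimensional ℂ (S.sp x)]
    (h : ∀ x, IsDirectSum (homAt ι x) (homAt ρ x) (homAt π x) (homAt σ x)) (r : ℤ)
    (hr : ∀ q : OfDim X f × OfDim S g,
      (Module.finrank ℂ (relHom q.1.1.carrier q.2.1.carrier) : ℤ) =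
        r + Module.finrank ℂ (nullHom q.1.1.carrier q.2.1.carrier)) :
    IsAffineBundle (OfDims.atlas ι π f g) ((OfDim.atlas X f).prod (OfDim.atlas S g))
      (OfDims.proj ι π f g) r := by
  -- A point of the base forces r ≥ 0, since `nullHom` lies in `relHom`; over an empty base the
  -- value of `toNat` is irrelevant.
  refine ⟨isMorphism_proj h, r.toNat, ?_, ?_⟩
  all_goals
    have hr0 (q : OfDim X f × OfDim S g) : (r.toNat : ℤ) = r := by
      refine Int.toNat_of_nonneg ?_
      have h1 := Submodule.finrank_mono (nullHom_le_relHom (fun b => q.1.1.stable b)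
        (fun b => q.2.1.stable b))
      have h2 := hr q
      omega
  · exact fun ⟨q⟩ => hr0 q
  · have hn : HasHomDim f g X S r.toNat := fun q => by
      have h1 := hr q
      rw [← hr0 q] at h1
      exact_mod_cast h1
    choose τ hτ using TrivData.exists_pt_eq hn
    refine ⟨fun q => (τ q).localTriv h hn, fun q => ?_, fun q q' x hx hx' => ?_⟩
    · have := (τ q).pt_mem_base
      rwa [hτ q] at this
    · replace hx : x ∈ (τ q).base := hx
      replace hx' : x ∈ (τ q').base := hx'
      refine ⟨(TrivData.transitionEquiv h hn (τ q) (τ q') hx hx').toAffineEquiv, ?_⟩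
      rintro u rfl
      exact (TrivData.transition_fibreCoord h (τ q) (τ q') hx hx').symm

end SubRep
end

noncomputable section

/-! ## Vanishing of `Ext¹` -/

/-- A short exact sequence splits if the group `Ext¹` of its ends vanishes. -/
lemma CategoryTheory.ShortComplex.ShortExact.nonempty_splitting_of_subsingleton_ext
    {C : Type*} [Category* C] [Abelian C] [HasExt.{w} C] {η : ShortComplex C}
    (hη : η.ShortExact) (h : Subsingleton (Abelian.Ext.{w} η.X₃ η.X₁ 1)) :
    Nonempty η.Splitting := by
  -- The connecting map sends the identity of X₃ into Ext¹(X₃, X₁) = 0, so the identity lifts to a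
  -- section.
  obtain ⟨x, hx⟩ := Abelian.Ext.covariant_sequence_exact₃ η.X₃ hη (Abelian.Ext.mk₀ (𝟙 η.X₃))
    (zero_add 1) (Subsingleton.elim _ _)
  obtain ⟨s, rfl⟩ := (Abelian.Ext.mk₀_bijective _ _).2 x
  rw [Abelian.Ext.mk₀_comp_mk₀] at hx
  exact ⟨.ofExactOfSection _ hη.exact s ((Abelian.Ext.mk₀_bijective _ _).1 hx) hη.mono_f⟩

/-! ### Extensions of representations given by cocycles. -/

namespace QRep

variable {W : Type u} [Quiver.{v} W] {T T' S X : QRep.{u, v, w} W}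

/-- A morphism of representations, given by its components. -/
def homOfComponents (φ : ∀ x, T.sp x →ₗ[ℂ] T'.sp x)
    (h : ∀ {x y : W} (b : x ⟶ y) (t : T.sp x), φ y (T.act b t) = T'.act b (φ x t)) : T ⟶ T' :=
  Paths.liftNatTrans (fun x => ModuleCat.ofHom (φ x)) fun b =>
    ModuleCat.hom_ext (LinearMap.ext fun t => h b t)

lemma hom_ext_homAt {φ ψ : T ⟶ T'} (h : ∀ x, homAt φ x = homAt ψ x) : φ = ψ :=
  NatTrans.ext (funext fun x => ModuleCat.hom_ext (h x))

/-- The representation with given spaces and maps. -/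
def ofMaps (E : W → Type w) [∀ x, AddCommGroup (E x)] [∀ x, Module ℂ (E x)]
    (m : ∀ {x y : W}, (x ⟶ y) → E x →ₗ[ℂ] E y) : QRep.{u, v, w} W :=
  Paths.lift { obj := fun x => ModuleCat.of ℂ (E x), map := fun b => ModuleCat.ofHom (m b) }

/-- The extension of `S` by `X` with given cocycle. -/
def extension (ψ : ArrowFamily S X) : QRep.{u, v, w} W :=
  ofMaps (fun x => X.sp x × S.sp x) fun {x y} b =>
    (X.act b ∘ₗ LinearMap.fst _ _ _ + ψ ⟨x, y, b⟩ ∘ₗ LinearMap.snd _ _ _).prod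
      (S.act b ∘ₗ LinearMap.snd _ _ _)

lemma extension_act (ψ : ArrowFamily S X) {x y : W} (b : x ⟶ y) (t : X.sp x × S.sp x) :
    (extension ψ).act b t = (X.act b t.1 + ψ ⟨x, y, b⟩ t.2, S.act b t.2) := rfl

lemma extension_hom {ψ : ArrowFamily S X} (k : T ⟶ extension ψ) :
    ∃ (p : HomFamily T X) (q : HomFamily T S), (∀ x t, homAt k x t = (p x t, q x t)) ∧
      ∀ {x y : W} (b : x ⟶ y) (t : T.sp x),
        p y (T.act b t) = X.act b (p x t) + ψ ⟨x, y, b⟩ (q x t) :=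
  let m (x : W) : T.sp x →ₗ[ℂ] X.sp x × S.sp x := homAt k x
  ⟨fun x => LinearMap.fst _ _ _ ∘ₗ m x, fun x => LinearMap.snd _ _ _ ∘ₗ m x, fun _ _ => rfl,
    fun b t => congrArg Prod.fst ((homAt_act k b t).trans (extension_act ψ b _))⟩

/-- The short exact sequence belonging to a cocycle. -/
def extensionComplex (ψ : ArrowFamily S X) : ShortComplex (QRep.{u, v, w} W) where
  X₁ := X
  X₂ := extension ψ
  X₃ := S
  f := homOfComponents (fun x => LinearMap.inl ℂ (X.sp x) (S.sp x)) fun {x y} b t => by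
    refine Eq.trans (Prod.ext ?_ ?_) (extension_act ψ b (t, 0)).symm
    · exact ((congrArg _ (map_zero (ψ ⟨x, y, b⟩))).trans (add_zero _)).symm
    · exact (map_zero (S.act b)).symm
  g := homOfComponents (fun x => LinearMap.snd ℂ (X.sp x) (S.sp x)) fun {x y} b t =>
    congrArg Prod.snd (extension_act ψ b t)
  zero := hom_ext_homAt fun x => LinearMap.snd_comp_inl ..

lemma extensionComplex_shortExact (ψ : ArrowFamily S X) : (extensionComplex ψ).ShortExact := by
  have hm : Mono (extensionComplex ψ).f := by
    have (x : Paths W) : Mono ((extensionComplex ψ).f.app x) :=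
      (ModuleCat.mono_iff_injective _).2 (LinearMap.inl_injective (R := ℂ) (M := X.sp x) (M₂ := S.sp x))
    exact NatTrans.mono_of_mono_app _
  have he : Epi (extensionComplex ψ).g := by
    have (x : Paths W) : Epi ((extensionComplex ψ).g.app x) :=
      (ModuleCat.epi_iff_surjective _).2 (LinearMap.snd_surjective (R := ℂ) (M := X.sp x) (M₂ := S.sp x))
    exact NatTrans.epi_of_epi_app _
  refine .mk' (ShortComplex.exact_of_f_is_kernel _ (Limits.KernelFork.IsLimit.ofι' _ _
    fun {Z} k hk => Classical.indefiniteDescription _ ?_)) hm he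
  obtain ⟨p, q, hpq, hp⟩ := extension_hom k
  have hq (x : W) (t : Z.sp x) : q x t = 0 :=
    (congrArg Prod.snd (hpq x t)).symm.trans (congrArg (fun m => homAt m x t) hk)
  refine ⟨homOfComponents p fun {x y} b t => ?_, hom_ext_homAt fun x => LinearMap.ext fun t => ?_⟩
  · have h1 := hp b t
    rw [hq, map_zero, add_zero] at h1
    exact h1
  · refine Eq.trans ?_ (hpq x t).symm
    rw [hq]
    rfl

/-- If `Ext¹(S, X)` vanishes, then every cocycle is a coboundary. -/
lemma ExtVanishes.exists_commutator_eq (h : ExtVanishes S X 1) (ψ : ArrowFamily S X) :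
    ∃ φ : HomFamily S X, commutator S X φ = ψ := by
  have := HasExt.standard (QRep.{u, v, w} W)
  obtain ⟨s⟩ := (extensionComplex_shortExact ψ).nonempty_splitting_of_subsingleton_ext h
  obtain ⟨p, q, hpq, hp⟩ := extension_hom (T := S) s.s
  have hq (x : W) (t : S.sp x) : q x t = t :=
    (congrArg Prod.snd (hpq x t)).symm.trans (congrArg (fun m => homAt m x t) s.s_g)
  -- The section is (p, id), and its compatibility with an arrow b reads p(bt) = b p(t) + ψ_b(t);
  -- hence the sign.
  refine ⟨-p, ?_⟩
  ext ⟨x, y, b⟩ t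
  rw [map_neg, Pi.neg_apply, LinearMap.neg_apply, commutator_apply, hp, hq]
  abel

end QRep
end

noncomputable section

/-! ## Dimension count -/

section LinearAlgebra

/-- Dimension count for a quotient of a three-term complex which is exact except in degree `0`. -/
lemma finrank_ker_comp_of_complex {M₀ M₁ M₂ C₀ C₁ C₂ : Type*}
    [AddCommGroup M₀] [Module ℂ M₀] [FiniteDimensional ℂ M₀]
    [AddCommGroup M₁] [Module ℂ M₁] [FiniteDimensional ℂ M₁]
    [AddCommGroup M₂] [Module ℂ M₂]
    [AddCommGroup C₀] [Module ℂ C₀] [AddCommGroup C₁] [Module ℂ C₁] [AddCommGroup C₂] [Module ℂ C₂]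
    {q₀ : M₀ →ₗ[ℂ] C₀} {q₁ : M₁ →ₗ[ℂ] C₁} {q₂ : M₂ →ₗ[ℂ] C₂} (hq₀ : Function.Surjective q₀)
    (hq₁ : Function.Surjective q₁) (hq₂ : Function.Surjective q₂)
    {D₀ : M₀ →ₗ[ℂ] M₁} {D₁ : M₁ →ₗ[ℂ] M₂} (hD₁ : Function.Surjective D₁)
    (hD : ∀ φ, D₁ (D₀ φ) = 0) (hker : ∀ ψ, q₁ ψ = 0 → q₂ (D₁ ψ) = 0)
    (hex : ∀ ψ, q₂ (D₁ ψ) = 0 → ∃ φ, q₁ ψ = q₁ (D₀ φ)) :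
    Module.finrank ℂ (LinearMap.ker (q₁ ∘ₗ D₀)) + Module.finrank ℂ C₁ =
      Module.finrank ℂ (LinearMap.ker q₀) + Module.finrank ℂ C₀ + Module.finrank ℂ C₂ := by
  have h0 := LinearMap.finrank_range_add_finrank_ker q₀
  have h1 := LinearMap.finrank_range_add_finrank_ker q₁
  have h2 := LinearMap.finrank_range_add_finrank_ker (q₂ ∘ₗ D₁)
  have h3 := LinearMap.finrank_range_add_finrank_ker (q₁ ∘ₗ D₀)
  -- Cocycles are taken in M₁ after passing to C₂; by exactness their image in C₁ is the range of q₁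
  -- ∘ D₀.
  have h4 := LinearMap.finrank_range_add_finrank_ker
    (q₁.domRestrict (LinearMap.ker (q₂ ∘ₗ D₁)))
  rw [LinearMap.range_eq_top.2 hq₀, finrank_top] at h0
  rw [LinearMap.range_eq_top.2 hq₁, finrank_top] at h1
  rw [LinearMap.range_eq_top.2 (show Function.Surjective (q₂ ∘ₗ D₁) from hq₂.comp hD₁),
    finrank_top] at h2
  have h5 : (LinearMap.ker (q₂ ∘ₗ D₁)).map q₁ = LinearMap.range (q₁ ∘ₗ D₀) := by
    ext z
    constructor
    · rintro ⟨ψ, hψ, rfl⟩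
      obtain ⟨φ, hφ⟩ := hex ψ hψ
      exact ⟨φ, hφ.symm⟩
    · rintro ⟨φ, rfl⟩
      refine ⟨D₀ φ, ?_, rfl⟩
      change q₂ (D₁ (D₀ φ)) = 0
      rw [hD, map_zero]
  have h6 : LinearMap.ker q₁ ≤ LinearMap.ker (q₂ ∘ₗ D₁) := hker
  rw [LinearMap.range_domRestrict, LinearMap.ker_domRestrict, h5,
    (Submodule.comapSubtypeEquivOfLe h6).finrank_eq] at h4
  omega

section RestrictQuot

variable {J : Type*} {S X : J → Type*} [∀ j, AddCommGroup (S j)] [∀ j, Module ℂ (S j)]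
  [∀ j, AddCommGroup (X j)] [∀ j, Module ℂ (X j)]

/-- Restriction of linear maps to subspaces, followed by projection to quotients. -/
def restrictQuot (A : ∀ j, Submodule ℂ (X j)) (B : ∀ j, Submodule ℂ (S j)) :
    (∀ j, S j →ₗ[ℂ] X j) →ₗ[ℂ] (∀ j, B j →ₗ[ℂ] (X j ⧸ A j)) :=
  LinearMap.pi fun j => (LinearMap.lcomp ℂ (X j ⧸ A j) (B j).subtype ∘ₗ
    LinearMap.compRight ℂ (A j).mkQ) ∘ₗ LinearMap.proj j

lemma restrictQuot_eq_zero_iff {A : ∀ j, Submodule ℂ (X j)} {B : ∀ j, Submodule ℂ (S j)}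
    {H : ∀ j, S j →ₗ[ℂ] X j} : restrictQuot A B H = 0 ↔ ∀ j, ∀ t ∈ B j, H j t ∈ A j := by
  rw [funext_iff]
  refine forall_congr' fun j => ?_
  rw [LinearMap.ext_iff]
  exact ⟨fun h t ht => (Submodule.Quotient.mk_eq_zero _).1 (h ⟨t, ht⟩),
    fun h t => (Submodule.Quotient.mk_eq_zero _).2 (h t.1 t.2)⟩

lemma restrictQuot_surjective (A : ∀ j, Submodule ℂ (X j)) (B : ∀ j, Submodule ℂ (S j)) :
    Function.Surjective (restrictQuot (S := S) (X := X) A B) := by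
  intro h
  choose s hs using fun j => (A j).mkQ.exists_rightInverse_of_surjective (A j).range_mkQ
  choose p hp using fun j =>
    (B j).subtype.exists_leftInverse_of_injective (Submodule.ker_subtype _)
  refine ⟨fun j => s j ∘ₗ h j ∘ₗ p j, funext fun j => LinearMap.ext fun t => ?_⟩
  change (A j).mkQ (s j (h j (p j t))) = h j t
  have h1 : p j t = t := LinearMap.congr_fun (hp j) t
  rw [h1]
  exact LinearMap.congr_fun (hs j) _

lemma finrank_restrictQuot [Fintype J] [∀ j, FiniteDimensional ℂ (S j)]
    [∀ j, FiniteDimensional ℂ (X j)]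
    (A : ∀ j, Submodule ℂ (X j)) (B : ∀ j, Submodule ℂ (S j)) :
    (Module.finrank ℂ (∀ j, B j →ₗ[ℂ] (X j ⧸ A j)) : ℤ) = ∑ j, (Module.finrank ℂ (B j) : ℤ) *
      ((Module.finrank ℂ (X j) : ℤ) - Module.finrank ℂ (A j)) := by
  rw [Module.finrank_pi_fintype, Nat.cast_sum]
  refine Finset.sum_congr rfl fun j _ => ?_
  have := (A j).finrank_quotient_add_finrank
  rw [Module.finrank_linearMap, Nat.cast_mul, ← this]
  push_cast
  ring

end RestrictQuot

variable {E E₁ : Type*} [AddCommGroup E] [Module ℂ E] [AddCommGroup E₁] [Module ℂ E₁]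

/-- A sequence of linear maps which is constant as a map of filtered spaces modulo a filtration
differs from a constant one only by maps into the filtration. -/
lemma exists_constant_of_filtered : ∀ {N : ℕ} (B : Fin N → Submodule ℂ E)
    (A : Fin N → Submodule ℂ E₁) (ψ : Fin N → E →ₗ[ℂ] E₁) (_ : Monotone B) (_ : Monotone A)
    (_ : ∀ n m : Fin N, n.val + 1 = m.val → ∀ t ∈ B n, ψ m t - ψ n t ∈ A m),
    ∃ θ : E →ₗ[ℂ] E₁, ∀ n, ∀ t ∈ B n, ψ n t - θ t ∈ A n
  | 0, _, _, _, _, _, _ => ⟨0, fun n => n.elim0⟩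
  | 1, _, A, ψ, _, _, _ => ⟨ψ 0, fun n t _ => by
      rw [Subsingleton.elim n 0, sub_self]
      exact (A 0).zero_mem⟩
  | N + 2, B, A, ψ, hB, hA, h => by
    obtain ⟨θ, hθ⟩ := exists_constant_of_filtered (N := N + 1) (fun n => B n.castSucc)
      (fun n => A n.castSucc) (fun n => ψ n.castSucc) (fun _ _ hnm => hB hnm)
      (fun _ _ hnm => hA hnm) fun n m hnm => h _ _ hnm
    set b : Fin (N + 2) := (Fin.last N).castSucc with hb
    obtain ⟨C, hC⟩ := (B b).exists_isCompl
    -- Keep θ on the last but one subspace, which contains all earlier ones, and use the last map on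
    -- a complement. On that subspace the last map differs from θ by elements of the last A, because
    -- the filtration A increases.
    refine ⟨θ ∘ₗ projAlong (B b) C + ψ (Fin.last _) ∘ₗ (1 - projAlong (B b) C), fun n => ?_⟩
    refine Fin.lastCases (fun t _ => ?_) (fun n t ht => ?_) n
    · have h1 := projAlong_mem hC t
      have h2 := h b (Fin.last _) rfl _ h1
      have h3 := hA (Fin.le_last b) (hθ (Fin.last N) _ h1)
      have h4 := (A _).add_mem h2 h3
      rw [sub_add_sub_cancel] at h4
      simp only [LinearMap.add_apply, LinearMap.comp_apply, LinearMap.sub_apply,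
        Module.End.one_apply, map_sub]
      convert h4 using 1
      abel
    · have h1 : t ∈ B b := hB (Fin.castSucc_le_castSucc_iff.2 (Fin.le_last n)) ht
      simp only [LinearMap.add_apply, LinearMap.comp_apply, LinearMap.sub_apply,
        Module.End.one_apply, projAlong_of_mem hC h1, sub_self, map_zero, add_zero]
      exact hθ n t ht

/-- Sequences with given differences. -/
lemma exists_fin_difference_eq {M : Type*} [AddCommGroup M] {N : ℕ}
    (Θ : ∀ n m : Fin N, n.val + 1 = m.val → M) :
    ∃ ψ : Fin N → M, ∀ n m h, ψ m - ψ n = Θ n m h := by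
  -- Partial sums. The default 0 is never reached, as t < m < N gives t + 1 < N.
  refine ⟨fun m => ∑ t ∈ Finset.range m.val,
    if h : t + 1 < N then Θ ⟨t, by omega⟩ ⟨t + 1, h⟩ rfl else 0, ?_⟩
  rintro ⟨n, hn⟩ ⟨m, hm⟩ h
  obtain rfl : n + 1 = m := h
  dsimp only
  rw [Finset.sum_range_succ, add_sub_cancel_left, dif_pos hm]

end LinearAlgebra
end

noncomputable section

/-! ## Levels of the extended quivers -/

namespace FlagKind

/-- The number of copies of each arrow of the quiver in the extended quiver. -/
def len (k : FlagKind) (d : ℕ) : ℕ :=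
  match k with
  | .plain => d
  | .strict => d - 1

variable {k : FlagKind} {d : ℕ}

/-- The level of the source of a copy of an arrow. -/
def srcLevel : ∀ {k : FlagKind}, Fin (k.len d) → Fin d
  | .plain, n => n
  | .strict, n => ⟨n.val + 1, Nat.add_lt_of_lt_sub n.2⟩

/-- The level of the target of a copy of an arrow. -/
def tgtLevel : ∀ {k : FlagKind}, Fin (k.len d) → Fin d
  | .plain, n => n
  | .strict, n => ⟨n.val, n.2.trans_le (Nat.sub_le d 1)⟩

lemma srcLevel_succ {n m : Fin (k.len d)} (h : n.val + 1 = m.val) :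
    (srcLevel n).val + 1 = (srcLevel m).val := by
  cases k
  · exact h
  · exact congrArg (· + 1) h

lemma tgtLevel_succ {n m : Fin (k.len d)} (h : n.val + 1 = m.val) :
    (tgtLevel n).val + 1 = (tgtLevel m).val := by
  cases k <;> exact h

lemma monotone_srcLevel : Monotone (srcLevel : Fin (k.len d) → Fin d) := by
  intro n m h
  cases k
  · exact h
  · exact Nat.succ_le_succ h

lemma monotone_tgtLevel : Monotone (tgtLevel : Fin (k.len d) → Fin d) := by
  intro n m h
  cases k <;> exact h

end FlagKind

open FlagKind

variable {k : FlagKind} {V : Type u} [Quiver.{v} V] {d : ℕ}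

/-- The copies of an arrow of the quiver in the extended quiver. -/
def ExtArrow.copy : ∀ {k : FlagKind} {i j : V} (_ : i ⟶ j) (n : Fin (k.len d)),
    ExtArrow k (i, srcLevel n) (j, tgtLevel n)
  | .plain, _, _, a, n => .plain a n
  | .strict, _, _, a, _ => .strict a rfl

/-- The virtual arrows between subsequent copies of an arrow. -/
def VirtualArrow.copy : ∀ {k : FlagKind} {i j : V} (_ : i ⟶ j) (n m : Fin (k.len d))
    (_ : n.val + 1 = m.val), VirtualArrow k (i, srcLevel n) (j, tgtLevel m)
  | .plain, _, _, a, _, _, h => .plain a h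
  | .strict, _, _, a, n, ⟨_, hm⟩, rfl =>
    .strict (q := ⟨n.val, n.2.trans_le (Nat.sub_le d 1)⟩)
      (s := ⟨n.val + 1 + 1, Nat.add_lt_of_lt_sub hm⟩) a rfl rfl

/-- Treats both kinds of quivers uniformly: strict copies are indexed by their target level, the
source lying one level higher. -/
lemma ExtArrow.induction_on {P : ∀ {x y : ExtVertex k V d}, ExtArrow k x y → Prop}
    (h : ∀ (i : V) {r s : Fin d} (h : r.val + 1 = s.val), P (ExtArrow.up i h))
    (h' : ∀ {i j : V} (a : i ⟶ j) (n : Fin (k.len d)), P (ExtArrow.copy a n))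
    {x y : ExtVertex k V d} (b : ExtArrow k x y) : P b := by
  cases b with
  | up i hrs => exact h i hrs
  | plain a r => exact h' a r
  | @strict i j a r s hrs =>
    obtain ⟨r, hr⟩ := r
    obtain rfl : s.val + 1 = r := hrs
    exact h' a ⟨s.val, Nat.lt_sub_of_add_lt hr⟩

/-- For both kinds the relations compare consecutive copies of one arrow, which is all that the
dimension count uses. -/
lemma VirtualArrow.induction_on {P : ∀ {x y : ExtVertex k V d}, VirtualArrow k x y → Prop}
    (h : ∀ {i j : V} (a : i ⟶ j) (n m : Fin (k.len d)) (h : n.val + 1 = m.val),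
      P (VirtualArrow.copy a n m h))
    {x y : ExtVertex k V d} (c : VirtualArrow k x y) : P c := by
  cases c with
  | plain a hrs => exact h a _ _ hrs
  | @strict i j a q r s hq hr =>
    obtain ⟨r, hr'⟩ := r
    obtain rfl : q.val + 1 = r := hq
    obtain ⟨s, hs⟩ := s
    obtain rfl : q.val + 1 + 1 = s := hr
    exact h a ⟨q.val, Nat.lt_sub_of_add_lt hr'⟩ ⟨q.val + 1, Nat.lt_sub_of_add_lt hs⟩ rfl

namespace QRep

variable {S X : QRep.{u, v, w} V}

/-- The action of an arrow of the extended quiver on `Φ(X)`. -/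
def phiAct (X : QRep.{u, v, w} V) : ∀ {x y : ExtVertex k V d}, ExtArrow k x y →
    (X.sp x.1 →ₗ[ℂ] X.sp y.1)
  | _, _, .up _ _ => LinearMap.id
  | _, _, .plain a _ => X.act a
  | _, _, .strict a _ => X.act a

lemma phiAct_copy {i j : V} (a : i ⟶ j) (n : Fin (k.len d)) :
    phiAct X (ExtArrow.copy (d := d) a n) = X.act a := by
  cases k <;> rfl

variable (k d)

/-- Families of linear maps at the vertices of the extended quiver. -/
abbrev ExtHomFamily (S X : QRep.{u, v, w} V) :=
  ∀ x : ExtVertex k V d, S.sp x.1 →ₗ[ℂ] X.sp x.1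

/-- Families of linear maps along the arrows of the extended quiver. -/
abbrev ExtArrowFamily (S X : QRep.{u, v, w} V) :=
  ∀ b : AllArrows k V d, S.sp b.1.1 →ₗ[ℂ] X.sp b.2.1.1

/-- Families of linear maps along the virtual arrows of the extended quiver. -/
abbrev ExtVirtualFamily (S X : QRep.{u, v, w} V) :=
  ∀ c : AllVirtualArrows k V d, S.sp c.1.1 →ₗ[ℂ] X.sp c.2.1.1

/-- The obstruction to being a morphism of representations of the extended quiver. -/
def extCommutator (S X : QRep.{u, v, w} V) :
    ExtHomFamily k d S X →ₗ[ℂ] ExtArrowFamily k d S X where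
  toFun H b := phiAct X b.2.2 ∘ₗ H b.1 - H b.2.1 ∘ₗ phiAct S b.2.2
  map_add' H H' := by
    ext b t
    simp only [LinearMap.sub_apply, LinearMap.comp_apply, Pi.add_apply, LinearMap.add_apply,
      map_add]
    abel
  map_smul' z H := by
    ext b t
    simp only [LinearMap.sub_apply, LinearMap.comp_apply, Pi.smul_apply, LinearMap.smul_apply,
      map_smul, RingHom.id_apply, smul_sub]

variable {k d}

/-- The component at a virtual arrow of the obstruction to satisfying the commutativity
relations to first order. -/
def virtualComponent (ψ : ExtArrowFamily k d S X) : ∀ {x y : ExtVertex k V d},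
    VirtualArrow k x y → (S.sp x.1 →ₗ[ℂ] X.sp y.1)
  | _, _, .plain (i := i) (j := j) a (r := r) (s := s) h =>
    X.act a ∘ₗ ψ ⟨_, _, .up i h⟩ + ψ ⟨_, _, .plain a s⟩ - ψ ⟨_, _, .plain a r⟩ -
      ψ ⟨_, _, .up j h⟩ ∘ₗ S.act a
  | _, _, .strict (i := i) (j := j) a h h' =>
    X.act a ∘ₗ ψ ⟨_, _, .up i h'⟩ + ψ ⟨_, _, .strict a h'⟩ - ψ ⟨_, _, .strict a h⟩ -
      ψ ⟨_, _, .up j h⟩ ∘ₗ S.act a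

lemma virtualComponent_copy (ψ : ExtArrowFamily k d S X) {i j : V} (a : i ⟶ j)
    (n m : Fin (k.len d)) (h : n.val + 1 = m.val) (t : S.sp i) :
    virtualComponent ψ (VirtualArrow.copy a n m h) t =
      X.act a (ψ ⟨_, _, .up i (srcLevel_succ h)⟩ t) + ψ ⟨_, _, .copy a m⟩ t -
        ψ ⟨_, _, .copy a n⟩ t - ψ ⟨_, _, .up j (tgtLevel_succ h)⟩ (S.act a t) := by
  cases k
  · rfl
  · obtain ⟨m, hm⟩ := m
    obtain rfl : n.val + 1 = m := h
    rfl

variable (k d) in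
/-- The obstruction to satisfying the commutativity relations to first order. -/
def extRelator (S X : QRep.{u, v, w} V) :
    ExtArrowFamily k d S X →ₗ[ℂ] ExtVirtualFamily k d S X where
  toFun ψ c := virtualComponent ψ c.2.2
  map_add' ψ ψ' := by
    refine funext fun ⟨x, y, c⟩ => ?_
    change virtualComponent (ψ + ψ') c = virtualComponent ψ c + virtualComponent ψ' c
    induction c using VirtualArrow.induction_on with | h a n m h => ?_
    ext t
    rw [LinearMap.add_apply, virtualComponent_copy, virtualComponent_copy, virtualComponent_copy]
    simp only [Pi.add_apply, LinearMap.add_apply, map_add]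
    abel
  map_smul' z ψ := by
    refine funext fun ⟨x, y, c⟩ => ?_
    change virtualComponent (z • ψ) c = z • virtualComponent ψ c
    induction c using VirtualArrow.induction_on with | h a n m h => ?_
    ext t
    rw [LinearMap.smul_apply, virtualComponent_copy, virtualComponent_copy]
    simp only [Pi.smul_apply, LinearMap.smul_apply, map_smul, smul_sub, smul_add]

lemma extRelator_copy (ψ : ExtArrowFamily k d S X) {i j : V} (a : i ⟶ j)
    (n m : Fin (k.len d)) (h : n.val + 1 = m.val) (t : S.sp i) :
    extRelator k d S X ψ ⟨_, _, .copy a n m h⟩ t =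
      X.act a (ψ ⟨_, _, .up i (srcLevel_succ h)⟩ t) + ψ ⟨_, _, .copy a m⟩ t -
        ψ ⟨_, _, .copy a n⟩ t - ψ ⟨_, _, .up j (tgtLevel_succ h)⟩ (S.act a t) :=
  virtualComponent_copy ψ a n m h t

lemma extCommutator_up (H : ExtHomFamily k d S X) (i : V) {r s : Fin d} (h : r.val + 1 = s.val)
    (t : S.sp i) : extCommutator k d S X H ⟨_, _, .up i h⟩ t = H (i, r) t - H (i, s) t := rfl

lemma extCommutator_copy (H : ExtHomFamily k d S X) {i j : V} (a : i ⟶ j) (n : Fin (k.len d))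
    (t : S.sp i) : extCommutator k d S X H ⟨_, _, .copy a n⟩ t =
      X.act a (H (i, srcLevel n) t) - H (j, tgtLevel n) (S.act a t) := by
  cases k <;> rfl

lemma extRelator_extCommutator (H : ExtHomFamily k d S X) :
    extRelator k d S X (extCommutator k d S X H) = 0 := by
  refine funext fun ⟨x, y, c⟩ => ?_
  induction c using VirtualArrow.induction_on with | @h i j a n m h => ?_
  refine LinearMap.ext fun (t : S.sp i) => (extRelator_copy _ a n m h t).trans ?_
  rw [extCommutator_copy, extCommutator_copy, extCommutator_up, extCommutator_up, map_sub]
  change _ = (0 : X.sp j)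
  abel

/-- A family along the arrows of the extended quiver which vanishes on the vertical arrows and is
given on the other ones. -/
lemma exists_extArrowFamily (F : ∀ {i j : V}, (i ⟶ j) → Fin (k.len d) → (S.sp i →ₗ[ℂ] X.sp j)) :
    ∃ ψ : ExtArrowFamily k d S X,
      (∀ (i : V) {r s : Fin d} (h : r.val + 1 = s.val), ψ ⟨_, _, .up i h⟩ = 0) ∧
      ∀ {i j : V} (a : i ⟶ j) (n : Fin (k.len d)), ψ ⟨_, _, .copy a n⟩ = F a n := by
  cases k
  · exact ⟨fun ⟨_, _, b⟩ => match b with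
      | .up _ _ => 0
      | .plain a r => F a r, fun _ _ _ _ => rfl, fun _ _ => rfl⟩
  · exact ⟨fun ⟨_, _, b⟩ => match b with
      | .up _ _ => 0
      | .strict a (r := r) (s := s) h => F a ⟨s.val, Nat.lt_sub_of_add_lt (h ▸ r.2)⟩,
      fun _ _ _ _ => rfl, fun _ _ => rfl⟩

/-- On families vanishing on the vertical arrows, the relator takes differences of consecutive
copies, and these can be prescribed. -/
lemma extRelator_surjective : Function.Surjective (extRelator k d S X) := by
  intro Θ
  choose F hF using fun (i j : V) (a : i ⟶ j) =>
    exists_fin_difference_eq (M := S.sp i →ₗ[ℂ] X.sp j) fun n m h => Θ ⟨_, _, .copy (k := k) (d := d) a n m h⟩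
  obtain ⟨ψ, h0, h1⟩ := exists_extArrowFamily (k := k) (d := d) (S := S) (X := X)
    fun {i j} a => F i j a
  refine ⟨ψ, ?_⟩
  refine funext fun ⟨x, y, c⟩ => ?_
  induction c using VirtualArrow.induction_on with | @h i j a n m h => ?_
  refine LinearMap.ext fun (t : S.sp i) => (extRelator_copy _ a n m h t).trans ?_
  rw [h0, h0, h1, h1, ← hF _ _ a n m h]
  simp

end QRep
end

noncomputable section

open FlagKind

/-! ## The Euler form as a dimension -/

namespace QRep

variable {k : FlagKind} {V : Type u} [Quiver.{v} V] {d : ℕ} {S X : QRep.{u, v, w} V}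

lemma monotone_of_le_succ {N : ℕ} {α : Type*} [Preorder α] {f : Fin N → α}
    (h : ∀ n m : Fin N, n.val + 1 = m.val → f n ≤ f m) : Monotone f := by
  cases N
  · exact fun n => n.elim0
  · exact Fin.monotone_iff_le_succ.2 fun n => h _ _ rfl

/-- Stability of a family of subspaces under the arrows of the extended quiver. -/
def IsPhiStable (A : ∀ x : ExtVertex k V d, Submodule ℂ (X.sp x.1)) : Prop :=
  ∀ (x y : ExtVertex k V d) (b : ExtArrow k x y), ∀ t ∈ A x, phiAct X b t ∈ A y

namespace IsPhiStable

variable {A : ∀ x : ExtVertex k V d, Submodule ℂ (X.sp x.1)} (hA : IsPhiStable A)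
include hA

lemma monotone (i : V) : Monotone (α := Fin d) (β := Submodule ℂ (X.sp i)) fun r => A (i, r) :=
  monotone_of_le_succ fun _ _ h t ht => hA _ _ (.up i h) t ht

lemma act_mem {i j : V} (a : i ⟶ j) (n : Fin (k.len d)) {t : X.sp i}
    (ht : t ∈ A (i, srcLevel n)) : X.act a t ∈ A (j, tgtLevel n) := by
  rw [← phiAct_copy (k := k) (d := d) a n]
  exact hA _ _ _ _ ht

end IsPhiStable

variable {A : ∀ x : ExtVertex k V d, Submodule ℂ (X.sp x.1)}
  {B : ∀ x : ExtVertex k V d, Submodule ℂ (S.sp x.1)}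

/-- Each of the four terms preserves the filtrations: the outer ones by stability under the arrow of
Q, the copies because A and B increase with the level. -/
lemma extRelator_mem (hA : IsPhiStable A) (hB : IsPhiStable B) {ψ : ExtArrowFamily k d S X}
    (hψ : ∀ b : AllArrows k V d, ∀ t ∈ B b.1, ψ b t ∈ A b.2.1) (c : AllVirtualArrows k V d) :
    ∀ t ∈ B c.1, extRelator k d S X ψ c t ∈ A c.2.1 := by
  obtain ⟨x, y, c⟩ := c
  induction c using VirtualArrow.induction_on with | @h i j a n m h => ?_
  intro (t : S.sp i) ht
  refine (congrArg (· ∈ A (j, tgtLevel m)) (extRelator_copy ψ a n m h t)).mpr ?_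
  have hnm : n ≤ m := Fin.le_def.2 (h ▸ Nat.le_succ _)
  refine Submodule.sub_mem _ (Submodule.sub_mem _ (Submodule.add_mem _ ?_ ?_) ?_) ?_
  · exact hA.act_mem a m (hψ ⟨_, _, .up i _⟩ t ht)
  · exact hψ ⟨_, _, .copy a m⟩ t (hB.monotone i (monotone_srcLevel hnm) ht)
  · exact hA.monotone j (monotone_tgtLevel hnm) (hψ ⟨_, _, .copy a n⟩ t ht)
  · exact hψ ⟨_, _, .up j _⟩ _ (hB.act_mem a n ht)

/-- Exactness in degree one. -/
lemma exists_extCommutator (hext : ∀ ψ : ArrowFamily S X, ∃ φ, commutator S X φ = ψ)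
    (hA : IsPhiStable A) (hB : IsPhiStable B) {ψ : ExtArrowFamily k d S X}
    (hψ : ∀ c : AllVirtualArrows k V d, ∀ t ∈ B c.1, extRelator k d S X ψ c t ∈ A c.2.1) :
    ∃ φ, ∀ b : AllArrows k V d, ∀ t ∈ B b.1, (ψ - extCommutator k d S X φ) b t ∈ A b.2.1 := by
  choose G hG using fun i : V => exists_fin_difference_eq (M := S.sp i →ₗ[ℂ] X.sp i)
    fun (r s : Fin d) (h : r.val + 1 = s.val) => ψ ⟨_, _, .up i h⟩
  -- `G` integrates ψ along the vertical arrows. The commutator there is source minus target, hence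
  -- the sign.
  let φ₀ : ExtHomFamily k d S X := fun x => -G x.1 x.2
  set ψ' := ψ - extCommutator k d S X φ₀ with hψ'
  have hup (i : V) {r s : Fin d} (h : r.val + 1 = s.val) (t : S.sp i) :
      ψ' ⟨_, _, .up i h⟩ t = 0 := by
    refine (congrArg₂ (· - ·) (LinearMap.congr_fun (hG i r s h) t).symm
      (extCommutator_up φ₀ i h t)).trans ?_
    simp only [φ₀, LinearMap.sub_apply, LinearMap.neg_apply]
    abel
  -- Without vertical components, the cocycle condition says that consecutive copies agree modulo A.
  have hdiff {i j : V} (a : i ⟶ j) (n m : Fin (k.len d)) (h : n.val + 1 = m.val)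
      (t : S.sp i) (ht : t ∈ B (i, srcLevel n)) :
      ψ' ⟨_, _, .copy a m⟩ t - ψ' ⟨_, _, .copy a n⟩ t ∈ A (j, tgtLevel m) := by
    have h1 := extRelator_copy ψ' a n m h t
    rw [hup, hup, map_zero, zero_add, sub_zero, hψ', map_sub, extRelator_extCommutator,
      sub_zero] at h1
    exact h1 ▸ hψ ⟨_, _, .copy a n m h⟩ t ht
  have hconst {i j : V} (a : i ⟶ j) : ∃ θ : S.sp i →ₗ[ℂ] X.sp j, ∀ n : Fin (k.len d),
      ∀ t : S.sp i, t ∈ B (i, srcLevel n) →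
        ψ' ⟨_, _, .copy a n⟩ t - θ t ∈ A (j, tgtLevel n) := by
    let B' : Fin (k.len d) → Submodule ℂ (S.sp i) := fun n => B (i, srcLevel n)
    let A' : Fin (k.len d) → Submodule ℂ (X.sp j) := fun n => A (j, tgtLevel n)
    let Ξ : Fin (k.len d) → S.sp i →ₗ[ℂ] X.sp j := fun n => ψ' ⟨_, _, .copy a n⟩
    exact exists_constant_of_filtered B' A' Ξ ((hB.monotone i).comp monotone_srcLevel)
      ((hA.monotone j).comp monotone_tgtLevel) (hdiff a)
  choose θ hθ using fun b : (Σ i j : V, i ⟶ j) => hconst b.2.2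
  obtain ⟨φ₁, hφ₁⟩ := hext θ
  -- The correction φ₁ from Q does not depend on the level, so it leaves the vertical components
  -- zero.
  refine ⟨φ₀ + fun x : ExtVertex k V d => φ₁ x.1, ?_⟩
  rw [map_add, ← sub_sub, ← hψ']
  rintro ⟨x, y, b⟩
  induction b using ExtArrow.induction_on with
  | @h i r s h =>
    intro (t : S.sp i) _
    refine (congrArg (· ∈ A (i, s)) (congrArg₂ (· - ·) (hup i h t)
      (extCommutator_up _ i h t))).mpr ?_
    simp
  | @h' i j a n =>
    intro (t : S.sp i) ht
    refine (congrArg (· ∈ A (j, tgtLevel n)) (congrArg (_ - ·)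
      ((extCommutator_copy _ a n t).trans ?_))).mpr (hθ ⟨i, j, a⟩ n t ht)
    exact LinearMap.congr_fun (congrFun hφ₁ ⟨i, j, a⟩) t

variable [Fintype V] [∀ i j : V, Fintype (i ⟶ j)]

/-- The dimension of the space of homomorphisms from a submodule of `Φ(S)` to a quotient of
`Φ(X)`. -/
lemma finrank_ker_extCommutator [∀ i, FiniteDimensional ℂ (S.sp i)]
    [∀ i, FiniteDimensional ℂ (X.sp i)]
    (hext : ∀ ψ : ArrowFamily S X, ∃ φ, commutator S X φ = ψ)
    (hA : IsPhiStable A) (hB : IsPhiStable B) :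
    (Module.finrank ℂ (LinearMap.ker (restrictQuot (fun b : AllArrows k V d => A b.2.1)
      (fun b => B b.1) ∘ₗ extCommutator k d S X)) : ℤ) =
      eulerForm (fun x => (Module.finrank ℂ (B x) : ℤ))
        (fun x => (Module.finrank ℂ (X.sp x.1) : ℤ) - Module.finrank ℂ (A x)) +
      Module.finrank ℂ (LinearMap.ker (restrictQuot (J := ExtVertex k V d)
        (S := fun x => S.sp x.1) (X := fun x => X.sp x.1) A B)) := by
  have h := finrank_ker_comp_of_complex
    (restrictQuot_surjective (S := fun x : ExtVertex k V d => S.sp x.1)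
      (X := fun x => X.sp x.1) A B)
    (restrictQuot_surjective (S := fun b : AllArrows k V d => S.sp b.1.1)
      (X := fun b => X.sp b.2.1.1) (fun b => A b.2.1) (fun b => B b.1))
    (restrictQuot_surjective (S := fun c : AllVirtualArrows k V d => S.sp c.1.1)
      (X := fun c => X.sp c.2.1.1) (fun c => A c.2.1) (fun c => B c.1))
    (extRelator_surjective (k := k) (d := d) (S := S) (X := X)) extRelator_extCommutator
    (fun ψ hψ => restrictQuot_eq_zero_iff.2
      (extRelator_mem hA hB (restrictQuot_eq_zero_iff.1 hψ)))
    (fun ψ hψ => by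
      obtain ⟨φ, hφ⟩ := exists_extCommutator hext hA hB (restrictQuot_eq_zero_iff.1 hψ)
      exact ⟨φ, sub_eq_zero.1 ((map_sub _ _ _).symm.trans (restrictQuot_eq_zero_iff.2 hφ))⟩)
  have h0 := finrank_restrictQuot (S := fun x : ExtVertex k V d => S.sp x.1)
      (X := fun x => X.sp x.1) A B
  have h1 := finrank_restrictQuot (S := fun b : AllArrows k V d => S.sp b.1.1)
      (X := fun b => X.sp b.2.1.1) (fun b => A b.2.1) (fun b => B b.1)
  have h2 := finrank_restrictQuot (S := fun c : AllVirtualArrows k V d => S.sp c.1.1)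
      (X := fun c => X.sp c.2.1.1) (fun c => A c.2.1) (fun c => B c.1)
  rw [eulerForm, ← h0, ← h1, ← h2]
  replace h := congrArg (Nat.cast : ℕ → ℤ) h
  push_cast at h
  linarith

end QRep
end

noncomputable section

/-! ## The functor `Φ` -/

namespace QRep

variable {k : FlagKind} {V : Type u} [Quiver.{v} V] {d : ℕ} {X Y S : QRep.{u, v, w} V}

lemma PhiRep_act (X : QRep.{u, v, w} V) {x y : ExtVertex k V d} (b : ExtArrow k x y)
    (t : X.sp x.1) : act (W := ExtVertex k V d) (PhiRep X) b t = phiAct X b t := by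
  cases b <;> rfl

lemma isPhiStable_carrier (U : SubRep (W := ExtVertex k V d) (PhiRep X)) :
    IsPhiStable (X := X) U.carrier := fun _ _ b t ht =>
  (congrArg (· ∈ U.carrier _) (PhiRep_act X b t)).mp (U.stable b t ht)

lemma homAt_splitting {η : ShortComplex (QRep.{u, v, w} V)} (s : η.Splitting) (i : V) :
    IsDirectSum (homAt η.f i) (homAt s.r i) (homAt η.g i) (homAt s.s i) where
  proj_inl x := congrArg (fun φ => homAt φ i x) s.f_r
  proj_inr x := congrArg (fun φ => homAt φ i x) s.s_g
  sum_eq x := congrArg (fun φ => homAt φ i x) s.id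

variable [Fintype V] [∀ i j : V, Fintype (i ⟶ j)]

instance : Finite (Σ x y : ExtVertex k V d, x ⟶ y) :=
  inferInstanceAs (Finite (AllArrows k V d))

lemma finrank_relHom_PhiRep [∀ i, FiniteDimensional ℂ (S.sp i)]
    [∀ i, FiniteDimensional ℂ (X.sp i)] (hext : ExtVanishes S X 1)
    (A : SubRep (W := ExtVertex k V d) (PhiRep X)) (B : SubRep (W := ExtVertex k V d) (PhiRep S)) :
    (Module.finrank ℂ (relHom A.carrier B.carrier) : ℤ) =
      eulerForm B.dimVec (dimVec (W := ExtVertex k V d) (PhiRep X) - A.dimVec) +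
        Module.finrank ℂ (nullHom A.carrier B.carrier) := by
  let A' (x : ExtVertex k V d) : Submodule ℂ (X.sp x.1) := A.carrier x
  let B' (x : ExtVertex k V d) : Submodule ℂ (S.sp x.1) := B.carrier x
  have h := finrank_ker_extCommutator (A := A') (B := B') hext.exists_commutator_eq
    (isPhiStable_carrier A) (isPhiStable_carrier B)
  have h1 : relHom A.carrier B.carrier = LinearMap.ker (restrictQuot
      (fun b : AllArrows k V d => A' b.2.1) (fun b => B' b.1) ∘ₗ extCommutator k d S X) := by
    ext H
    refine Iff.trans ?_ restrictQuot_eq_zero_iff.symm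
    refine forall_congr' fun b => forall₂_congr fun t _ => iff_of_eq ?_
    refine congrArg (· ∈ A' b.2.1) (congrArg₂ (· - ·) (PhiRep_act X b.2.2 _) ?_)
    exact congrArg (H b.2.1) (PhiRep_act S b.2.2 t)
  have h2 : nullHom A.carrier B.carrier = LinearMap.ker (restrictQuot (J := ExtVertex k V d)
      (S := fun x => S.sp x.1) (X := fun x => X.sp x.1) A' B') := by
    ext H
    exact restrictQuot_eq_zero_iff.symm
  rw [h1, h2]
  exact h

end QRep

end

/-! ### The main theorem. -/

theorem mainTheorem4 {V : Type u} [Quiver.{v} V] [Fintype V] [∀ i j : V, Fintype (i ⟶ j)]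
    (k : FlagKind) (d : ℕ) (hd : 1 ≤ d) (hk : k = FlagKind.strict → 2 ≤ d)
    (η : ShortComplex (QRep.{u, v, w} V)) (hη : η.ShortExact)
    (hX : η.X₁.IsFinDim) (hY : η.X₂.IsFinDim) (hS : η.X₃.IsFinDim) :
    (Nonempty η.Splitting → Function.Surjective (Psi k d η)) ∧
    (QRep.ExtVanishes η.X₃ η.X₁ 1 →
      ∀ f g : ExtVertex k V d → ℤ,
        IsAffineBundle (GrFiber.atlas k d η f g)
          ((GrDim.atlas ((Phi k d).obj η.X₁) f).prod (GrDim.atlas ((Phi k d).obj η.X₃) g))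
          (PsiDim k d η f g)
          (eulerForm g (((Phi k d).obj η.X₁).obj.dimVec - f))) := by
  have hsum (s : η.Splitting) (x : ExtVertex k V d) :
      IsDirectSum (QRep.homAt ((Phi k d).map η.f).hom x) (QRep.homAt ((Phi k d).map s.r).hom x)
        (QRep.homAt ((Phi k d).map η.g).hom x) (QRep.homAt ((Phi k d).map s.s).hom x) :=
    QRep.homAt_splitting s x.1
  -- The graph of the zero family, that is A ⊕ B, is a preimage of (A, B).
  refine ⟨fun ⟨s⟩ ⟨A, B⟩ => ⟨_, Prod.ext (SubRep.comap_graph (hsum s) (zero_mem _))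
    (SubRep.map_graph (hsum s) (zero_mem _))⟩, fun hext f g => ?_⟩
  have := HasExt.standard (QRep.{u, v, w} V)
  obtain ⟨s⟩ := hη.nonempty_splitting_of_subsingleton_ext hext
  have (i : V) : FiniteDimensional ℂ (η.X₁.sp i) := hX i
  have (i : V) : FiniteDimensional ℂ (η.X₃.sp i) := hS i
  have (x : ExtVertex k V d) : FiniteDimensional ℂ (((Phi k d).obj η.X₁).obj.sp x) := hX x.1
  have (x : ExtVertex k V d) : FiniteDimensional ℂ (((Phi k d).obj η.X₂).obj.sp x) := hY x.1
  have (x : ExtVertex k V d) : FiniteDimensional ℂ (((Phi k d).obj η.X₃).obj.sp x) := hS x.1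
  refine SubRep.isAffineBundle_proj (hsum s) _ ?_
  rintro ⟨⟨A, rfl⟩, ⟨B, rfl⟩⟩
  exact QRep.finrank_relHom_PhiRep hext A B
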